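/- Let $d\ge 1$, $Y=[0,2\pi)^d$, and let $A=(a_{jk})_{j,k=1}^d$ be a matrix of real, bounded, measurable functions on $\mathbb{R}^d$ which is symmetric, $Y$-periodic ($A(y+2\pi p)=A(y)$ for all $p\in\mathbb{Z}^d$ and a.e. $y$) and elliptic: there is $\alpha>0$ with $A(y)\xi\cdot\xi\ge\alpha|\xi|^2$ for all $\xi\in\mathbb{R}^d$ and a.e. $y$. Write $\mathcal{M}_Y(u)=\frac1{|Y|}\int_Y u\,dy$, let $\hat u(n)=\mathcal{M}_Y(u\,e^{-in\cdot y})$, and for $s\in\{1,2\}$ let $H^s_\sharp(Y)$ be the space of $Y$-periodic $u\in L^2_\sharp(Y)$ with $\|u\|_{H^s}=\big(\sum_{n\in\mathbb{Z}^d}(1+|n|^2)^s|\hat u(n)|^2\big)^{1/2}<\infty$. For $\rho\ge 1$ and $\eta\in\mathbb{R}^d$ consider the eigenvalue problem $$\mathcal{A}^\rho(\eta)\phi=\rho^2(\nabla+i\eta)^4\phi-(\nabla+i\eta)\cdot A(y)(\nabla+i\eta)\phi=\lambda\phi,\qquad \phi\in H^2_\sharp(Y)\setminus\{0\},$$ understood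 weakly: for all $v\in H^2_\sharp(Y)$, $$\int_Y A(\nabla+i\eta)\phi\cdot\overline{(\nabla+i\eta)v}\,dy+\rho^2\int_Y(\nabla+i\eta)^2\phi\,\overline{(\nabla+i\eta)^2v}\,dy=\lambda\int_Y\phi\,\overline{v}\,dy .$$ Let $\lambda_1^\rho(\eta)$ be the smallest eigenvalue and $\phi_1^\rho(\cdot;\eta)$ the corresponding eigenfunction normalized by $\mathcal{M}_Y(\phi_1^\rho(\cdot;\eta))=(2\pi)^{-d/2}$. For every $\rho\ge1$ these are well defined for $\eta$ in a neighbourhood of $0$ (the smallest eigenvalue exists and the normalized eigenfunction exists and is unique), and $\eta\mapsto\lambda_1^\rho(\eta)\in\mathbb{R}$ and $\eta\mapsto\phi_1^\rho(\cdot;\eta)\in H^2_\sharp(Y)$ are real analytic at $\eta=0$. For a multi-index $\beta\in\mathbb{N}_0^d$ write $\partial_0^\beta$ for the derivative $\partial_\eta^\beta$ evaluated at $\eta=0$, $|\beta|=\beta_1+\dots+\beta_d$, and $e_j$ for the $j$-th unit multi-index (and the $j$-th unit vector). Then, for all $1\le\rho<\infty$, where $a\lesssim b$ means $a\le Cb$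 with a constant $C$ that does not depend on $\rho$ (it may depend on $A$, $d$ and the order of differentiation): 1. $\|\partial_0^{e_j}\phi_1^\rho\|_{H^1}\lesssim\rho^{-2}$ and $\partial_0^{e_j}\lambda_1^\rho=0$ for all $j$; 2. $\|\partial_0^{e_j+e_k}\phi_1^\rho\|_{H^1}\lesssim\rho^{-2}$ and $\left|\tfrac12\partial_0^{e_j+e_k}\lambda_1^\rho-\mathcal{M}_Y(e_j\cdot Ae_k)\right|\lesssim\rho^{-2}$ for all $j,k$; 3. $\|\partial_0^{e_j+e_k+e_l}\phi_1^\rho\|_{H^1}\lesssim\rho^{-2}$ and $\partial_0^{e_j+e_k+e_l}\lambda_1^\rho=0$ for all $j,k,l$; 4. $\|\partial_0^{\beta}\phi_1^\rho\|_{H^1}\lesssim1$ for every $\beta$ with $|\beta|\ge4$; 5. $|\partial_0^\beta\lambda_1^\rho|\lesssim\rho^2$ for every $\beta$ with $|\beta|=4$, and $|\partial_0^\beta\lambda_1^\rho|\lesssim1$ for every $\beta$ with $|\beta|>4$. -/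

import Mathlib

open MeasureTheory Filter Topology
open scoped ENNReal ComplexConjugate

noncomputable section

namespace BlochWave

/-- The basic periodicity cell `Y = [0, 2π)^d`. -/
def cellY (d : ℕ) : Set (Fin d → ℝ) := Set.univ.pi fun _ => Set.Ico 0 (2 * Real.pi)

/-- Lebesgue measure on the cell. -/
abbrev muY (d : ℕ) : Measure (Fin d → ℝ) := (volume : Measure (Fin d → ℝ)).restrict (cellY d)

/-- `L²_♯(Y)`: a periodic function is given by its restriction to the cell. -/
abbrev L2Y (d : ℕ) : Type := Lp ℂ 2 (muY d)

/-- The character `e^{i n·y}`. -/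
def expY {d : ℕ} (n : Fin d → ℤ) (y : Fin d → ℝ) : ℂ :=
  Complex.exp (Complex.I * ∑ j, (n j : ℂ) * (y j : ℂ))

/-- The mean value `M_Y(f) = |Y|⁻¹ ∫_Y f`, with `|Y| = (2π)^d`. -/
def meanY {d : ℕ} {E : Type*} [NormedAddCommGroup E] [NormedSpace ℝ E]
    (f : (Fin d → ℝ) → E) : E :=
  ((2 * Real.pi) ^ d : ℝ)⁻¹ • ∫ y in cellY d, f y

/-- Fourier coefficient `û(n) = |Y|⁻¹ ∫_Y u(y) e^{-i n·y} dy`. -/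
def fourierY {d : ℕ} (u : L2Y d) (n : Fin d → ℤ) : ℂ :=
  meanY fun y => u y * conj (expY n y)

/-- The representative in `(0, 2π]` of `2π x`, for `x ∈ ℝ/ℤ`. -/
def unrollAux (x : UnitAddCircle) : ℝ := 2 * Real.pi * (AddCircle.equivIoc 1 0 x).1

theorem measurePreserving_unrollAux :
    MeasurePreserving unrollAux (volume : Measure UnitAddCircle)
      (ENNReal.ofReal (2 * Real.pi)⁻¹ • volume.restrict (Set.Ioc 0 (2 * Real.pi))) := by
  have hpi : (0 : ℝ) < 2 * Real.pi := by positivity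
  have h1 : MeasurePreserving (fun x : UnitAddCircle => (AddCircle.equivIoc 1 0 x).1) volume
      (volume.restrict (Set.Ioc (0 : ℝ) (0 + 1))) :=
    (measurePreserving_subtype_coe measurableSet_Ioc).comp
      (AddCircle.measurePreserving_equivIoc 1 (a := 0))
  have h2 : MeasurePreserving (fun t : ℝ => 2 * Real.pi * t)
      (volume.restrict (Set.Ioc (0 : ℝ) (0 + 1)))
      (ENNReal.ofReal (2 * Real.pi)⁻¹ • volume.restrict (Set.Ioc 0 (2 * Real.pi))) := by
    refine ⟨by fun_prop, ?_⟩
    have h3 := Real.map_volume_mul_left hpi.ne'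
    rw [abs_of_pos (inv_pos.2 hpi)] at h3
    rw [← Measure.restrict_smul, ← h3, Measure.restrict_map (by fun_prop) measurableSet_Ioc]
    congr 2
    ext t
    simp only [Set.mem_Ioc, Set.mem_preimage, zero_add]
    constructor
    · rintro ⟨a, b⟩; exact ⟨by positivity, by nlinarith⟩
    · rintro ⟨a, b⟩; exact ⟨by by_contra h; nlinarith, by nlinarith⟩
  exact h2.comp h1

/-- The parametrization of the cell by the unit torus. -/
def unroll {d : ℕ} (x : UnitAddTorus (Fin d)) : Fin d → ℝ := fun j => unrollAux (x j)

theorem measurePreserving_unroll (d : ℕ) :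
    MeasurePreserving (unroll (d := d))
      (Measure.pi fun _ : Fin d => (volume : Measure UnitAddCircle))
      (ENNReal.ofReal ((2 * Real.pi) ^ d)⁻¹ • muY d) := by
  have hpi : (0 : ℝ) < 2 * Real.pi := by positivity
  have hfin : IsFiniteMeasure (ENNReal.ofReal (2 * Real.pi)⁻¹ •
      (volume : Measure ℝ).restrict (Set.Ioc 0 (2 * Real.pi))) :=
    Measure.smul_finite _ ENNReal.ofReal_ne_top
  have h := measurePreserving_pi (fun _ : Fin d => (volume : Measure UnitAddCircle))
    (fun _ => ENNReal.ofReal (2 * Real.pi)⁻¹ • volume.restrict (Set.Ioc 0 (2 * Real.pi)))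
    (fun _ => measurePreserving_unrollAux)
  convert! h using 1
  symm
  refine Measure.pi_eq fun s hs => ?_
  have : muY d = Measure.pi fun _ : Fin d => (volume : Measure ℝ).restrict
      (Set.Ico 0 (2 * Real.pi)) := Measure.restrict_pi_pi _ _
  rw [Measure.smul_apply, this, Measure.pi_pi]
  simp only [Measure.smul_apply, smul_eq_mul, Finset.prod_mul_distrib, Finset.prod_const,
    Finset.card_univ, Fintype.card_fin]
  rw [← inv_pow, ENNReal.ofReal_pow (by positivity)]
  congr 1
  refine Finset.prod_congr rfl fun j _ => ?_
  rw [Measure.restrict_congr_set (Ico_ae_eq_Ioc)]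

theorem mFourier_eq_unroll {d : ℕ} (n : Fin d → ℤ) (x : UnitAddTorus (Fin d)) :
    UnitAddTorus.mFourier n x = expY n (unroll x) := by
  have h1 : ∀ z : UnitAddCircle, ((AddCircle.equivIoc 1 0 z).1 : UnitAddCircle) = z := fun z =>
    (AddCircle.equivIoc (1 : ℝ) 0).symm_apply_apply z
  have h2 : UnitAddTorus.mFourier n x = ∏ j, fourier (n j) (x j) := rfl
  rw [h2, expY, Finset.mul_sum, Complex.exp_sum]
  refine Finset.prod_congr rfl fun j _ => ?_
  conv_lhs => rw [← h1 (x j)]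
  rw [fourier_coe_apply]
  simp only [unroll, unrollAux]
  push_cast
  congr 1
  ring

/-- Parseval's identity on the cell. -/
theorem hasSum_sq_fourierY {d : ℕ} (u : L2Y d) :
    HasSum (fun n => ‖fourierY u n‖ ^ 2) (meanY fun y => ‖u y‖ ^ 2) := by
  have hpi : (0 : ℝ) < (2 * Real.pi) ^ d := by positivity
  have hm := measurePreserving_unroll d
  have hμ : (Measure.pi fun _ : Fin d => (volume : Measure UnitAddCircle)) =
      Measure.pi fun _ : Fin d => (AddCircle.haarAddCircle : Measure UnitAddCircle) := by
    simp [AddCircle.volume_eq_smul_haarAddCircle]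
  rw [hμ] at hm
  have hint : ∀ {E : Type} [NormedAddCommGroup E] [NormedSpace ℝ E] (F : (Fin d → ℝ) → E),
      AEStronglyMeasurable F (muY d) →
      ∫ x, F (unroll x) ∂(Measure.pi fun _ : Fin d =>
        (AddCircle.haarAddCircle : Measure UnitAddCircle)) = meanY F := by
    intro E _ _ F hF
    rw [← integral_map hm.measurable.aemeasurable (by
      rw [hm.map_eq]; exact hF.mono_ac Measure.smul_absolutelyContinuous), hm.map_eq,
      integral_smul_measure, ENNReal.toReal_ofReal (by positivity)]
    rfl
  have hu : MemLp (u : (Fin d → ℝ) → ℂ) 2 (ENNReal.ofReal ((2 * Real.pi) ^ d)⁻¹ • muY d) :=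
    (Lp.memLp u).smul_measure ENNReal.ofReal_ne_top
  have hg := hu.comp_measurePreserving hm
  have hP := UnitAddTorus.hasSum_sq_mFourierCoeff (d := Fin d) (hg.toLp _)
  have hco := hg.coeFn_toLp
  have hmeas := (Lp.aestronglyMeasurable u)
  have hexp : ∀ n : Fin d → ℤ, Continuous (expY n) := fun n => by unfold expY; fun_prop
  convert! hP using 1
  · funext n
    congr 2
    unfold fourierY UnitAddTorus.mFourierCoeff
    have hE : AEStronglyMeasurable (fun y => u y * conj (expY n y)) (muY d) :=
      hmeas.mul (Complex.continuous_conj.comp (hexp n)).aestronglyMeasurable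
    rw [← hint _ hE]
    refine integral_congr_ae ?_
    filter_upwards [hco] with x hx
    rw [hx, UnitAddTorus.mFourier_neg, mFourier_eq_unroll, smul_eq_mul, mul_comm]
    rfl
  · rw [← hint _ (by fun_prop)]
    refine integral_congr_ae ?_
    filter_upwards [hco] with x hx
    rw [hx]
    rfl

theorem integrableOn_mul_expY {d : ℕ} (u : L2Y d) (n : Fin d → ℤ) :
    IntegrableOn (fun y => u y * conj (expY n y)) (cellY d) := by
  have hfin : IsFiniteMeasure (muY d) := by
    refine ⟨?_⟩
    rw [Measure.restrict_apply_univ, cellY, volume_pi_pi]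
    exact ENNReal.prod_lt_top fun j _ => by
      rw [Real.volume_Ico]
      exact ENNReal.ofReal_lt_top
  have h1 : Integrable (u : (Fin d → ℝ) → ℂ) (muY d) := (Lp.memLp u).integrable (by norm_num)
  have hexp : Continuous (expY n) := by unfold expY; fun_prop
  refine h1.mul_bdd (c := 1) (Complex.continuous_conj.comp hexp).aestronglyMeasurable ?_
  refine Filter.Eventually.of_forall fun y => ?_
  simp [expY, Complex.norm_exp]

theorem fourierY_add {d : ℕ} (u v : L2Y d) (n : Fin d → ℤ) :
    fourierY (u + v) n = fourierY u n + fourierY v n := by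
  unfold fourierY meanY
  rw [← smul_add, ← integral_add (integrableOn_mul_expY u n) (integrableOn_mul_expY v n)]
  congr 1
  refine integral_congr_ae ?_
  filter_upwards [Lp.coeFn_add u v] with y hy
  rw [hy, Pi.add_apply, add_mul]

theorem fourierY_smul {d : ℕ} (c : ℂ) (u : L2Y d) (n : Fin d → ℤ) :
    fourierY (c • u) n = c * fourierY u n := by
  unfold fourierY meanY
  rw [mul_smul_comm, ← integral_const_mul]
  congr 1
  refine integral_congr_ae ?_
  filter_upwards [Lp.coeFn_smul c u] with y hy
  rw [hy, Pi.smul_apply, smul_eq_mul, mul_assoc]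

theorem eq_zero_of_fourierY {d : ℕ} (u : L2Y d) (h : ∀ n, fourierY u n = 0) : u = 0 := by
  have hpi : (0 : ℝ) < (2 * Real.pi) ^ d := by positivity
  have h1 := hasSum_sq_fourierY u
  simp only [h, norm_zero, ne_eq, OfNat.ofNat_ne_zero, not_false_eq_true, zero_pow] at h1
  have h2 := h1.unique hasSum_zero
  unfold meanY at h2
  rw [smul_eq_mul, mul_eq_zero, or_iff_right (inv_pos.2 hpi).ne',
    integral_eq_zero_iff_of_nonneg (fun _ => by positivity)
      ((memLp_two_iff_integrable_sq_norm (Lp.aestronglyMeasurable u)).1 (Lp.memLp u))] at h2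
  refine (Lp.eq_zero_iff_ae_eq_zero).2 ?_
  filter_upwards [h2] with y hy
  simpa using hy

/-- The weight `(1 + |n|²)^s`. -/
def sobolevWeight {d : ℕ} (s : ℕ) (n : Fin d → ℤ) : ℝ := (1 + ∑ j, (n j : ℝ) ^ 2) ^ s

theorem sobolevWeight_pos {d : ℕ} (s : ℕ) (n : Fin d → ℤ) : 0 < sobolevWeight s n := by
  unfold sobolevWeight; positivity

/-- The norm `(∑ₙ (1 + |n|²)^s |û(n)|²)^{1/2}` of `H^s_♯(Y)`. -/
def sobolevNorm {d : ℕ} (s : ℕ) (u : L2Y d) : ℝ :=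
  √(∑' n, sobolevWeight s n * ‖fourierY u n‖ ^ 2)

/-- `H^s_♯(Y)` as a subspace of `L²_♯(Y)`: the functions with finite `H^s` norm. -/
def sobolevSubmodule (d s : ℕ) : Submodule ℂ (L2Y d) where
  carrier := {u | Summable fun n => sobolevWeight s n * ‖fourierY u n‖ ^ 2}
  zero_mem' := by
    have h (n : Fin d → ℤ) : fourierY (0 : L2Y d) n = 0 := by
      simpa using fourierY_smul (0 : ℂ) (0 : L2Y d) n
    simp [h]
  add_mem' := by
    intro u v hu hv
    simp only [Set.mem_ofPred_eq] at hu hv ⊢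
    refine Summable.of_nonneg_of_le
      (fun n => mul_nonneg (sobolevWeight_pos s n).le (by positivity)) (fun n => ?_)
      ((hu.add hv).mul_left 2)
    rw [fourierY_add, ← mul_add, mul_left_comm]
    refine mul_le_mul_of_nonneg_left ?_ (sobolevWeight_pos s n).le
    have h1 := norm_add_le (fourierY u n) (fourierY v n)
    have h2 := norm_nonneg (fourierY u n + fourierY v n)
    nlinarith [sq_nonneg (‖fourierY u n‖ - ‖fourierY v n‖)]
  smul_mem' := by
    intro c u hu
    simp only [Set.mem_ofPred_eq] at hu ⊢
    refine (hu.mul_left (‖c‖ ^ 2)).congr fun n => ?_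
    rw [fourierY_smul, norm_mul]
    ring

/-- The space `H^s_♯(Y)`, carrying its own norm (not that of `L²`). -/
def HY (d s : ℕ) : Type := sobolevSubmodule d s

instance (d s : ℕ) : AddCommGroup (HY d s) := inferInstanceAs (AddCommGroup (sobolevSubmodule d s))

instance (d s : ℕ) : Module ℂ (HY d s) := inferInstanceAs (Module ℂ (sobolevSubmodule d s))

/-- The inclusion `H^s_♯(Y) ⊆ L²_♯(Y)`. -/
def HY.toL2 {d s : ℕ} : HY d s →ₗ[ℂ] L2Y d := (sobolevSubmodule d s).subtype

/-- The sequence of weighted Fourier coefficients of `u ∈ H^s_♯(Y)`. -/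
def HY.toSeq {d s : ℕ} : HY d s →ₗ[ℂ] lp (fun _ : Fin d → ℤ => ℂ) 2 where
  toFun u := ⟨fun n => (√(sobolevWeight s n) : ℂ) * fourierY (HY.toL2 u) n, by
    refine memℓp_gen ?_
    have hu : Summable fun n => sobolevWeight s n * ‖fourierY (HY.toL2 u) n‖ ^ 2 := u.2
    refine hu.congr fun n => ?_
    simp [mul_pow, Real.sq_sqrt (sobolevWeight_pos s n).le]⟩
  map_add' u v := by
    ext n
    simp only [map_add, fourierY_add, mul_add]
    rfl
  map_smul' c u := by
    ext n
    simp [fourierY_smul, mul_left_comm]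

theorem HY.toSeq_injective {d s : ℕ} : Function.Injective (HY.toSeq (d := d) (s := s)) := by
  refine (injective_iff_map_eq_zero _).2 fun u hu => ?_
  have h1 : HY.toL2 u = 0 := eq_zero_of_fourierY _ fun n => by
    have h2 : (√(sobolevWeight s n) : ℂ) * fourierY (HY.toL2 u) n = 0 :=
      congrFun (congrArg Subtype.val hu) n
    refine (mul_eq_zero.1 h2).resolve_left ?_
    exact_mod_cast (Real.sqrt_pos.2 (sobolevWeight_pos s n)).ne'
  exact Subtype.ext h1

instance (d s : ℕ) : NormedAddCommGroup (HY d s) :=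
  NormedAddCommGroup.induced (HY d s) (lp (fun _ : Fin d → ℤ => ℂ) 2) HY.toSeq HY.toSeq_injective

instance (d s : ℕ) : NormedSpace ℂ (HY d s) :=
  NormedSpace.induced ℂ (HY d s) (lp (fun _ : Fin d → ℤ => ℂ) 2) HY.toSeq

theorem HY.norm_eq {d s : ℕ} (u : HY d s) : ‖u‖ = sobolevNorm s (HY.toL2 u) := by
  have h1 : ‖u‖ = ‖HY.toSeq u‖ := rfl
  have h2 := lp.norm_rpow_eq_tsum (p := 2) (by norm_num) (HY.toSeq u)
  rw [h1, sobolevNorm, eq_comm, Real.sqrt_eq_iff_eq_sq (tsum_nonneg fun n =>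
    mul_nonneg (sobolevWeight_pos s n).le (by positivity)) (norm_nonneg _)]
  simp only [ENNReal.toReal_ofNat, Real.rpow_ofNat] at h2
  rw [h2]
  refine tsum_congr fun n => ?_
  have h3 : (HY.toSeq u) n = (√(sobolevWeight s n) : ℂ) * fourierY (HY.toL2 u) n := rfl
  rw [h3]
  simp [mul_pow, Real.sq_sqrt (sobolevWeight_pos s n).le]

open Classical in
/-- The periodic distributional derivative `∂u/∂y_j`: the function `g ∈ L²_♯(Y)` with
`ĝ(n) = i n_j û(n)` for all `n`, if there is one (it is then unique), and `0` otherwise. -/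
def pderivY {d : ℕ} (j : Fin d) (u : L2Y d) : L2Y d :=
  if h : ∃ g : L2Y d, ∀ n, fourierY g n = Complex.I * (n j : ℂ) * fourierY u n then h.choose else 0

/-- The `j`-th component of `(∇ + iη)u`. -/
def shiftGrad {d : ℕ} (η : Fin d → ℝ) (j : Fin d) (u : L2Y d) : L2Y d :=
  pderivY j u + (Complex.I * (η j : ℂ)) • u

/-- `(∇ + iη)²u = (∇ + iη)·(∇ + iη)u`. -/
def shiftLaplacian {d : ℕ} (η : Fin d → ℝ) (u : L2Y d) : L2Y d :=
  ∑ j, shiftGrad η j (shiftGrad η j u)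

/-- The standing assumptions on the coefficient matrix: real, bounded, measurable entries;
uniform ellipticity; `Y`-periodicity; symmetry. -/
structure IsPeriodicElliptic {d : ℕ} (A : (Fin d → ℝ) → Matrix (Fin d) (Fin d) ℝ) : Prop where
  measurable : ∀ j k, Measurable fun y => A y j k
  bounded : ∃ M : ℝ, ∀ j k, ∀ᵐ y, |A y j k| ≤ M
  elliptic : ∃ α : ℝ, 0 < α ∧ ∀ᵐ y, ∀ ξ : Fin d → ℝ,
    α * ∑ j, ξ j ^ 2 ≤ ∑ j, (∑ k, A y j k * ξ k) * ξ j
  periodic : ∀ p : Fin d → ℤ, ∀ᵐ y, A (fun j => y j + 2 * Real.pi * p j) = A y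
  symm : ∀ᵐ y, (A y).IsSymm

/-- The form `a^ρ[η](u,v) = ∫_Y A(∇+iη)u·conj((∇+iη)v) + ρ² ∫_Y (∇+iη)²u conj((∇+iη)²v)`. -/
def blochForm {d : ℕ} (A : (Fin d → ℝ) → Matrix (Fin d) (Fin d) ℝ) (ρ : ℝ) (η : Fin d → ℝ)
    (u v : L2Y d) : ℂ :=
  (∫ y in cellY d, ∑ j, (∑ k, (A y j k : ℂ) * shiftGrad η k u y) * conj (shiftGrad η j v y)) +
    (ρ : ℂ) ^ 2 * ∫ y in cellY d, shiftLaplacian η u y * conj (shiftLaplacian η v y)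

/-- `φ ∈ H²_♯(Y)` is an eigenfunction, with eigenvalue `lam`, of the shifted operator
`A^ρ(η) = ρ²(∇+iη)⁴ - (∇+iη)·A(∇+iη)` (the operator of the form `a^ρ[η]`). -/
def IsBlochEigenfunction {d : ℕ} (A : (Fin d → ℝ) → Matrix (Fin d) (Fin d) ℝ) (ρ : ℝ)
    (η : Fin d → ℝ) (lam : ℝ) (φ : HY d 2) : Prop :=
  φ ≠ 0 ∧ ∀ v : HY d 2, blochForm A ρ η (HY.toL2 φ) (HY.toL2 v) =
    (lam : ℂ) * ∫ y in cellY d, HY.toL2 φ y * conj (HY.toL2 v y)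

/-- The set of Bloch eigenvalues at `η`. -/
def blochEigenvalues {d : ℕ} (A : (Fin d → ℝ) → Matrix (Fin d) (Fin d) ℝ) (ρ : ℝ)
    (η : Fin d → ℝ) : Set ℝ :=
  {lam | ∃ φ, IsBlochEigenfunction A ρ η lam φ}

/-- The first Bloch eigenvalue `λ₁^ρ(η)`. -/
def firstEigenvalue {d : ℕ} (A : (Fin d → ℝ) → Matrix (Fin d) (Fin d) ℝ) (ρ : ℝ)
    (η : Fin d → ℝ) : ℝ :=
  sInf (blochEigenvalues A ρ η)

/-- `φ` is an eigenfunction for the first Bloch eigenvalue, normalized by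
`M_Y(φ) = (2π)^{-d/2}`. -/
def IsNormalizedGroundState {d : ℕ} (A : (Fin d → ℝ) → Matrix (Fin d) (Fin d) ℝ) (ρ : ℝ)
    (η : Fin d → ℝ) (φ : HY d 2) : Prop :=
  IsBlochEigenfunction A ρ η (firstEigenvalue A ρ η) φ ∧
    meanY (HY.toL2 φ : (Fin d → ℝ) → ℂ) = (((2 * Real.pi) ^ (-(d : ℝ) / 2) : ℝ) : ℂ)

open Classical in
/-- The first Bloch eigenfunction `φ₁^ρ(·;η)`, normalized by its mean value (and `0` at the `η`,
away from the origin, where no such normalization is possible). -/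
def firstEigenfunction {d : ℕ} (A : (Fin d → ℝ) → Matrix (Fin d) (Fin d) ℝ) (ρ : ℝ)
    (η : Fin d → ℝ) : HY d 2 :=
  if h : ∃ φ, IsNormalizedGroundState A ρ η φ then h.choose else 0

/-- The partial derivative `∂f/∂η_j`. -/
def partialEta {d : ℕ} {E : Type*} [NormedAddCommGroup E] [NormedSpace ℝ E] (j : Fin d)
    (f : (Fin d → ℝ) → E) : (Fin d → ℝ) → E :=
  fun η => fderiv ℝ f η (Pi.single j 1)

/-- `∂^β f = ∂^{β_1}/∂η_1^{β_1} ⋯ ∂^{β_d}/∂η_d^{β_d} f` for a multi-index `β`. -/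
def multiPartial {d : ℕ} {E : Type*} [NormedAddCommGroup E] [NormedSpace ℝ E] (β : Fin d → ℕ)
    (f : (Fin d → ℝ) → E) : (Fin d → ℝ) → E :=
  (List.finRange d).foldr (fun j g => (partialEta j)^[β j] g) f

/-- `‖∂^β φ₁^ρ|_{η=0}‖_{H¹}`. -/
def eigenfunctionDerivNorm {d : ℕ} (A : (Fin d → ℝ) → Matrix (Fin d) (Fin d) ℝ) (ρ : ℝ)
    (β : Fin d → ℕ) : ℝ :=
  sobolevNorm 1 (HY.toL2 (multiPartial β (firstEigenfunction A ρ) 0))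

/-- `∂^β λ₁^ρ|_{η=0}`. -/
def eigenvalueDeriv {d : ℕ} (A : (Fin d → ℝ) → Matrix (Fin d) (Fin d) ℝ) (ρ : ℝ)
    (β : Fin d → ℕ) : ℝ :=
  multiPartial β (firstEigenvalue A ρ) 0

/-- The multi-index `e_j`. -/
def unitIndex {d : ℕ} (j : Fin d) : Fin d → ℕ := Pi.single j 1

end BlochWave

end

/-!
Write `ε = ρ⁻²`. Constants solve the problem at `η = 0`, and the ansatz `φ = (2π)^(-d/2) (1 + ε χ)`
with `χ` of mean zero is a Lyapunov–Schmidt reduction: testing with constants expresses `λ / ρ²` as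
`|η|⁴ + ε M_Y(A) η · η + ε² r(η, χ)`, and what is left, divided by `ρ²`, is an equation for `χ`
which is analytic in `(η, ε, χ)` and makes sense for `ε = 0` as well. Its linearization at
`η = 0`, `χ = 0` is the operator `Δ² - ε ∇ · A ∇`, which the biharmonic term alone makes coercive on
mean-zero functions. The implicit function theorem gives an analytic branch `χ(η, ε)` near every
`(0, ε₀)` with `ε₀ ≥ 0`, and compactness of `[0, 1] ∋ ε` makes the bounds on its derivatives uniform
in `ρ ≥ 1`. Coercivity of the shifted form on mean-zero functions shows that the branch is the
first eigenvalue and that the normalized eigenfunction is unique. Complex conjugation gives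
`λ(-η) = λ(η)`, so the derivatives of odd order vanish; the remaining claims are read off the
homogeneous polynomials `|η|⁴` and `M_Y(A) η · η`.
-/

noncomputable section

open scoped ContDiff InnerProductSpace Matrix

namespace BlochWave

section ComplexContDiff

variable {E : Type*} [NormedAddCommGroup E] [NormedSpace ℝ E]

@[fun_prop]
theorem contDiff_ofReal {f : E → ℝ} (hf : ContDiff ℝ ω f) : ContDiff ℝ ω fun x => (f x : ℂ) :=
  Complex.ofRealCLM.contDiff.comp hf

theorem contDiff_clm_apply {U V : Type*} [NormedAddCommGroup U] [NormedSpace ℂ U]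
    [NormedAddCommGroup V] [NormedSpace ℂ V] {f : E → U →L[ℂ] V} {g : E → U}
    (hf : ContDiff ℝ ω f) (hg : ContDiff ℝ ω g) : ContDiff ℝ ω fun x => f x (g x) :=
  ((ContinuousLinearMap.restrictScalarsL ℂ U V ℝ ℝ).contDiff.comp hf).clm_apply hg

variable {W K : Type*} [NormedAddCommGroup W] [InnerProductSpace ℂ W] [CompleteSpace W]
  [NormedAddCommGroup K] [InnerProductSpace ℂ K] [CompleteSpace K]

theorem contDiff_adjoint {f : E → W →L[ℂ] K} (hf : ContDiff ℝ ω f) :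
    ContDiff ℝ ω fun x => ContinuousLinearMap.adjoint (f x) := by
  have hlin : IsBoundedLinearMap ℝ fun T : W →L[ℂ] K => ContinuousLinearMap.adjoint T :=
    ⟨⟨fun S T => map_add _ S T, fun c T => by
      rw [← Complex.coe_smul, map_smulₛₗ, Complex.conj_ofReal, Complex.coe_smul]⟩,
      ⟨1, one_pos, fun T => by simp⟩⟩
  exact hlin.contDiff.comp hf

theorem isInvertible_of_coercive {T : W →L[ℂ] W} {c : ℝ} (hc : 0 < c)
    (hT : ∀ v, c * ‖v‖ * ‖v‖ ≤ (⟪v, T v⟫_ℂ).re) : (T.restrictScalars ℝ).IsInvertible := by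
  let _ : InnerProductSpace ℝ W := InnerProductSpace.complexToReal
  have hB : IsCoercive (innerSL ℝ ∘L T.restrictScalars ℝ : W →L[ℝ] W →L[ℝ] ℝ) :=
    ⟨c, hc, fun v => (hT v).trans_eq (inner_re_symm (𝕜 := ℂ) v (T v))⟩
  refine ⟨hB.continuousLinearEquivOfBilin, ?_⟩
  ext v
  refine ext_inner_right ℝ fun w => ?_
  rw [ContinuousLinearEquiv.coe_coe, hB.continuousLinearEquivOfBilin_apply]
  rfl

end ComplexContDiff

/-- The operators entering the sesquilinear form of a fourth order Bloch problem: the inclusion of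
the form domain, the partial derivatives, the Laplacian, and multiplication by the entries of the
coefficient matrix. -/
structure FormData (d : ℕ) (W K : Type*) [NormedAddCommGroup W] [InnerProductSpace ℂ W]
    [NormedAddCommGroup K] [InnerProductSpace ℂ K] where
  incl : W →L[ℂ] K
  grad : Fin d → W →L[ℂ] K
  lap : W →L[ℂ] K
  coef : Fin d → Fin d → K →L[ℂ] K

namespace FormData

variable {d : ℕ} {W K : Type*} [NormedAddCommGroup W] [InnerProductSpace ℂ W]
  [NormedAddCommGroup K] [InnerProductSpace ℂ K] (F : FormData d W K)

/-- The `j`-th component of `∇ + iη`. -/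
def gradOp (η : Fin d → ℝ) (j : Fin d) : W →L[ℂ] K :=
  F.grad j + (Complex.I * (η j : ℂ)) • F.incl

/-- The shifted Laplacian `(∇ + iη)²`, multiplied out. -/
def lapOp (η : Fin d → ℝ) : W →L[ℂ] K :=
  F.lap + ∑ j, (2 * Complex.I * (η j : ℂ)) • F.grad j - (∑ j, (η j : ℂ) ^ 2) • F.incl

/-- The sesquilinear form of the shifted fourth order operator. -/
def form (ρ : ℝ) (η : Fin d → ℝ) (u v : W) : ℂ :=
  ∑ j, ⟪F.gradOp η j v, ∑ k, F.coef j k (F.gradOp η k u)⟫_ℂ +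
    (ρ : ℂ) ^ 2 * ⟪F.lapOp η v, F.lapOp η u⟫_ℂ

/-- `φ` is an eigenvector of the form, with eigenvalue `lam`. -/
def IsEigenvector (ρ : ℝ) (η : Fin d → ℝ) (lam : ℝ) (φ : W) : Prop :=
  φ ≠ 0 ∧ ∀ v, F.form ρ η φ v = (lam : ℂ) * ⟪F.incl v, F.incl φ⟫_ℂ

/-- The coefficient matrix is positive semidefinite. -/
def CoefNonneg : Prop :=
  ∀ ξ : Fin d → K, 0 ≤ (∑ j, ⟪ξ j, ∑ k, F.coef j k (ξ k)⟫_ℂ).re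

/-- The coefficient matrix is symmetric. -/
def CoefSymm : Prop := ∀ j k x y, ⟪x, F.coef j k y⟫_ℂ = ⟪F.coef k j x, y⟫_ℂ

/-- Restriction of the operators to a subspace of the form domain. -/
def restrict (X : Submodule ℂ W) : FormData d X K where
  incl := F.incl ∘L X.subtypeL
  grad j := F.grad j ∘L X.subtypeL
  lap := F.lap ∘L X.subtypeL
  coef := F.coef

@[simp]
theorem gradOp_restrict (X : Submodule ℂ W) (η : Fin d → ℝ) (j : Fin d) (x : X) :
    (F.restrict X).gradOp η j x = F.gradOp η j x := by
  simp [gradOp, restrict]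

@[simp]
theorem lapOp_restrict (X : Submodule ℂ W) (η : Fin d → ℝ) (x : X) :
    (F.restrict X).lapOp η x = F.lapOp η x := by
  simp [lapOp, restrict]

@[simp]
theorem lapOp_zero : F.lapOp 0 = F.lap := by
  simp [lapOp]

/-- The flux of `o + ε χ`, where `o` plays the role of a constant function. -/
def flux (o : K) (η : Fin d → ℝ) (ε : ℝ) (χ : W) (j : Fin d) : K :=
  ∑ k, F.coef j k ((Complex.I * (η k : ℂ)) • o + (ε : ℂ) • F.gradOp η k χ)

/-- The contribution of the corrector `χ` to the flux tested against the constant `o`. -/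
def correctorFlux (o : K) (η : Fin d → ℝ) (χ : W) : ℂ :=
  ∑ j, ⟪(Complex.I * (η j : ℂ)) • o, ∑ k, F.coef j k (F.gradOp η k χ)⟫_ℂ

/-- The eigenvalue belonging to `o + ε χ` in units of `ρ² = ε⁻¹`, found by testing the eigenvalue
equation against the constant `o`. -/
def scaledEigenvalue (o : K) (η : Fin d → ℝ) (ε : ℝ) (χ : W) : ℂ :=
  (∑ j, (η j : ℂ) ^ 2) ^ 2 +
    ((ε / ‖o‖ ^ 2 : ℝ) : ℂ) * ∑ j, ⟪(Complex.I * (η j : ℂ)) • o, F.flux o η ε χ j⟫_ℂ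

theorem sum_inner_flux (o : K) (η : Fin d → ℝ) (ε : ℝ) (χ : W) :
    ∑ j, ⟪(Complex.I * (η j : ℂ)) • o, F.flux o η ε χ j⟫_ℂ =
      ∑ j, ∑ k, (η j : ℂ) * (η k : ℂ) * ⟪o, F.coef j k o⟫_ℂ + ε * F.correctorFlux o η χ := by
  simp only [correctorFlux, flux, map_add, map_smul, inner_sum, inner_add_right,
    Finset.mul_sum, ← Finset.sum_add_distrib]
  refine Finset.sum_congr rfl fun j _ => Finset.sum_congr rfl fun k _ => ?_
  simp only [inner_smul_left, inner_smul_right, map_mul, Complex.conj_I, Complex.conj_ofReal]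
  linear_combination -(η j * η k * ⟪o, F.coef j k o⟫_ℂ : ℂ) * Complex.I_sq

theorem contDiff_gradOp (j : Fin d) : ContDiff ℝ ω fun η : Fin d → ℝ => F.gradOp η j := by
  unfold gradOp
  fun_prop

theorem contDiff_lapOp : ContDiff ℝ ω F.lapOp := by
  unfold lapOp
  fun_prop

theorem contDiff_gradOp_apply (j : Fin d) :
    ContDiff ℝ ω fun p : (Fin d → ℝ) × W => F.gradOp p.1 j p.2 :=
  contDiff_clm_apply ((F.contDiff_gradOp j).comp contDiff_fst) contDiff_snd

theorem contDiff_flux (o : K) (j : Fin d) :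
    ContDiff ℝ ω fun p : ((Fin d → ℝ) × ℝ) × W => F.flux o p.1.1 p.1.2 p.2 j := by
  unfold flux
  refine ContDiff.sum fun k _ => contDiff_clm_apply contDiff_const ?_
  have hgrad : ContDiff ℝ ω fun p : ((Fin d → ℝ) × ℝ) × W => F.gradOp p.1.1 k p.2 :=
    contDiff_clm_apply ((F.contDiff_gradOp k).comp (contDiff_fst.comp contDiff_fst)) contDiff_snd
  fun_prop

theorem contDiff_correctorFlux (o : K) :
    ContDiff ℝ ω fun p : (Fin d → ℝ) × W => F.correctorFlux o p.1 p.2 :=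
  ContDiff.sum fun j _ => ContDiff.inner ℂ (by fun_prop) <|
    ContDiff.sum fun k _ => contDiff_clm_apply contDiff_const (F.contDiff_gradOp_apply k)

theorem analyticAt_correctorFlux (o : K) {E : Type*} [NormedAddCommGroup E] [NormedSpace ℝ E]
    {f : E → Fin d → ℝ} {χ : E → W} {x : E} (hf : AnalyticAt ℝ f x) (hχ : AnalyticAt ℝ χ x) :
    AnalyticAt ℝ (fun y => F.correctorFlux o (f y) (χ y)) x :=
  (F.contDiff_correctorFlux o).contDiffAt.analyticAt.comp_of_eq (hf.prod hχ) rfl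

theorem contDiff_scaledEigenvalue (o : K) :
    ContDiff ℝ ω fun p : ((Fin d → ℝ) × ℝ) × W => F.scaledEigenvalue o p.1.1 p.1.2 p.2 := by
  have hflux (j : Fin d) : ContDiff ℝ ω fun p : ((Fin d → ℝ) × ℝ) × W =>
      ⟪(Complex.I * (p.1.1 j : ℂ)) • o, F.flux o p.1.1 p.1.2 p.2 j⟫_ℂ :=
    ContDiff.inner ℂ (by fun_prop) (F.contDiff_flux o j)
  unfold scaledEigenvalue
  fun_prop

section Residual

variable [CompleteSpace W] [CompleteSpace K]

open ContinuousLinearMap (adjoint)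

/-- The residual of the equation for the corrector `χ`, with the eigenvalue eliminated. It is
divided by `ρ²`, so that it still makes sense in the limit `ε = 0`. -/
def residual (o : K) (η : Fin d → ℝ) (ε : ℝ) (χ : W) : W :=
  adjoint (F.lapOp η) (F.lapOp η χ) + ∑ j, adjoint (F.gradOp η j) (F.flux o η ε χ j) -
    F.scaledEigenvalue o η ε χ • adjoint F.incl (F.incl χ)

theorem inner_residual (o : K) (η : Fin d → ℝ) (ε : ℝ) (χ v : W) :
    ⟪v, F.residual o η ε χ⟫_ℂ = ⟪F.lapOp η v, F.lapOp η χ⟫_ℂ +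
      ∑ j, ⟪F.gradOp η j v, F.flux o η ε χ j⟫_ℂ -
      F.scaledEigenvalue o η ε χ * ⟪F.incl v, F.incl χ⟫_ℂ := by
  simp [residual, ContinuousLinearMap.adjoint_inner_right]

theorem contDiff_residual (o : K) :
    ContDiff ℝ ω fun p : ((Fin d → ℝ) × ℝ) × W => F.residual o p.1.1 p.1.2 p.2 := by
  have hη : ContDiff ℝ ω fun p : ((Fin d → ℝ) × ℝ) × W => p.1.1 := by fun_prop
  have hlap : ContDiff ℝ ω fun p : ((Fin d → ℝ) × ℝ) × W => F.lapOp p.1.1 :=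
    F.contDiff_lapOp.comp hη
  have hmass : ContDiff ℝ ω fun p : ((Fin d → ℝ) × ℝ) × W => adjoint F.incl (F.incl p.2) :=
    contDiff_clm_apply contDiff_const (contDiff_clm_apply contDiff_const contDiff_snd)
  refine ((contDiff_clm_apply (contDiff_adjoint hlap) (contDiff_clm_apply hlap contDiff_snd)).add
    (ContDiff.sum fun j _ => ?_)).sub ((F.contDiff_scaledEigenvalue o).smul hmass)
  exact contDiff_clm_apply (contDiff_adjoint ((F.contDiff_gradOp j).comp hη)) (F.contDiff_flux o j)

/-- The derivative of the residual with respect to the corrector at `η = 0`. -/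
def linearization (ε : ℝ) : W →L[ℂ] W :=
  adjoint F.lap ∘L F.lap +
    ∑ j, adjoint (F.grad j) ∘L ∑ k, (ε : ℂ) • (F.coef j k ∘L F.grad k)

theorem residual_zero (o : K) (ε : ℝ) (χ : W) : F.residual o 0 ε χ = F.linearization ε χ := by
  simp [residual, linearization, gradOp, flux, scaledEigenvalue]

variable {F}

theorem isInvertible_linearization (hF : F.CoefNonneg) {c : ℝ} (hc : 0 < c)
    (hlap : ∀ x, c * ‖x‖ ≤ ‖F.lap x‖) {ε : ℝ} (hε : 0 ≤ ε) :
    ((F.linearization ε).restrictScalars ℝ).IsInvertible := by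
  refine isInvertible_of_coercive (c := c * c) (by positivity) fun v => ?_
  have hv : ⟪v, F.linearization ε v⟫_ℂ = ⟪F.lap v, F.lap v⟫_ℂ +
      (ε : ℂ) * ∑ j, ⟪F.grad j v, ∑ k, F.coef j k (F.grad k v)⟫_ℂ := by
    simp [linearization, ContinuousLinearMap.adjoint_inner_right, Finset.mul_sum]
  have hnorm : (⟪F.lap v, F.lap v⟫_ℂ).re = ‖F.lap v‖ * ‖F.lap v‖ :=
    inner_self_eq_norm_mul_norm (𝕜 := ℂ) _
  rw [hv, Complex.add_re, Complex.re_ofReal_mul, hnorm]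
  have hnonneg := mul_nonneg hε (hF fun j => F.grad j v)
  have hsq := mul_self_le_mul_self (by positivity) (hlap v)
  linarith [mul_mul_mul_comm c ‖v‖ c ‖v‖, mul_assoc (c * c) ‖v‖ ‖v‖]

theorem exists_analyticAt_residual_eq_zero (hF : F.CoefNonneg) {c : ℝ} (hc : 0 < c)
    (hlap : ∀ x, c * ‖x‖ ≤ ‖F.lap x‖) (o : K) {ε₀ : ℝ} (hε₀ : 0 ≤ ε₀) :
    ∃ χ : (Fin d → ℝ) × ℝ → W, AnalyticAt ℝ χ (0, ε₀) ∧
      ∀ᶠ p in 𝓝 (0, ε₀), F.residual o p.1 p.2 (χ p) = 0 := by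
  set f : ((Fin d → ℝ) × ℝ) × W → W := fun p => F.residual o p.1.1 p.1.2 p.2
  set u : ((Fin d → ℝ) × ℝ) × W := ((0, ε₀), 0)
  have hf : ContDiffAt ℝ ω f u := (F.contDiff_residual o).contDiffAt
  have hinv : (fderiv ℝ f u ∘L .inr ℝ ((Fin d → ℝ) × ℝ) W).IsInvertible := by
    have hslice : HasFDerivAt (fun χ => f (u.1, χ)) (fderiv ℝ f u ∘L .inr ℝ _ W) (0 : W) :=
      (hf.differentiableAt (by simp)).hasFDerivAt.comp (0 : W) (hasFDerivAt_prodMk_right u.1 0)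
    have hlinear : (fun χ => f (u.1, χ)) = (F.linearization ε₀).restrictScalars ℝ :=
      funext (F.residual_zero o ε₀)
    rw [hlinear] at hslice
    rw [hslice.unique ((F.linearization ε₀).restrictScalars ℝ).hasFDerivAt]
    exact isInvertible_linearization hF hc hlap hε₀
  have hω : (ω : WithTop ℕ∞) ≠ 0 := by simp
  refine ⟨hf.implicitFunction hω hinv, (hf.contDiffAt_implicitFunction hω hinv).analyticAt, ?_⟩
  filter_upwards [hf.eventually_apply_implicitFunction hω hinv] with p hp
  exact hp.trans (by simp [f, u, residual_zero])

end Residual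

section Form

variable (ρ : ℝ) (η : Fin d → ℝ)

theorem form_add_right (u v v' : W) :
    F.form ρ η u (v + v') = F.form ρ η u v + F.form ρ η u v' := by
  simp only [form, map_add, inner_add_left, Finset.sum_add_distrib]
  ring

theorem form_smul_right (a : ℂ) (u v : W) : F.form ρ η u (a • v) = conj a * F.form ρ η u v := by
  simp only [form, map_smul, inner_smul_left, ← Finset.mul_sum]
  ring

theorem form_smul_left (a : ℂ) (u v : W) : F.form ρ η (a • u) v = a * F.form ρ η u v := by
  simp only [form, map_smul, ← Finset.smul_sum, inner_smul_right, ← Finset.mul_sum]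
  ring

theorem form_sub_left (u u' v : W) : F.form ρ η (u - u') v = F.form ρ η u v - F.form ρ η u' v := by
  simp only [form, map_sub, inner_sub_right, Finset.sum_sub_distrib]
  ring

theorem re_form_self (u : W) :
    (F.form ρ η u u).re = (∑ j, ⟪F.gradOp η j u, ∑ k, F.coef j k (F.gradOp η k u)⟫_ℂ).re +
      ρ ^ 2 * ‖F.lapOp η u‖ ^ 2 := by
  rw [form, inner_self_eq_norm_sq_to_K, Complex.add_re, ← Complex.ofReal_pow,
    Complex.re_ofReal_mul]
  norm_cast

variable {F}

theorem form_conj (hF : F.CoefSymm) (u v : W) : conj (F.form ρ η u v) = F.form ρ η v u := by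
  simp only [form, map_add, map_sum, map_mul, inner_sum, inner_conj_symm, hF _ _]
  rw [Finset.sum_comm]
  simp

end Form

section Eigenvector

variable {F} {ρ : ℝ} {η : Fin d → ℝ} {lam lam' : ℝ} {φ φ' : W}

theorem IsEigenvector.smul (h : F.IsEigenvector ρ η lam φ) {a : ℂ} (ha : a ≠ 0) :
    F.IsEigenvector ρ η lam (a • φ) := by
  refine ⟨smul_ne_zero ha h.1, fun v => ?_⟩
  rw [form_smul_left, h.2, map_smul, inner_smul_right]
  ring

theorem IsEigenvector.re_form_self (h : F.IsEigenvector ρ η lam φ) :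
    (F.form ρ η φ φ).re = lam * ‖F.incl φ‖ ^ 2 := by
  rw [h.2, inner_self_eq_norm_sq_to_K, Complex.re_ofReal_mul]
  norm_cast

theorem IsEigenvector.inner_eq_zero (hF : F.CoefSymm) (h : F.IsEigenvector ρ η lam φ)
    (h' : F.IsEigenvector ρ η lam' φ') (hne : lam ≠ lam') : ⟪F.incl φ, F.incl φ'⟫_ℂ = 0 := by
  have hconj := form_conj ρ η hF φ φ'
  rw [h.2, h'.2, map_mul, inner_conj_symm, Complex.conj_ofReal, ← sub_eq_zero, ← sub_mul] at hconj
  exact (mul_eq_zero.1 hconj).resolve_left (sub_ne_zero.2 (mod_cast hne))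

theorem IsEigenvector.re_form_sub_le (hF : F.CoefSymm) (h : F.IsEigenvector ρ η lam φ)
    (h' : F.IsEigenvector ρ η lam' φ') :
    (F.form ρ η (φ - φ') (φ - φ')).re ≤ max lam lam' * ‖F.incl (φ - φ')‖ ^ 2 := by
  obtain rfl | hne := eq_or_ne lam lam'
  · rw [form_sub_left, h.2, h'.2, ← mul_sub, ← inner_sub_right, ← map_sub,
      inner_self_eq_norm_sq_to_K, Complex.re_ofReal_mul, max_self]
    norm_cast
  · have horth := h.inner_eq_zero hF h' hne
    have horth' := inner_eq_zero_symm.1 horth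
    have hform : F.form ρ η (φ - φ') (φ - φ') = F.form ρ η φ φ + F.form ρ η φ' φ' := by
      rw [form_sub_left, h.2, h'.2, h.2, h'.2, map_sub, inner_sub_left, inner_sub_left,
        horth, horth']
      ring
    have hnorm : ‖F.incl (φ - φ')‖ ^ 2 = ‖F.incl φ‖ ^ 2 + ‖F.incl φ'‖ ^ 2 := by
      rw [map_sub, norm_sub_sq (𝕜 := ℂ), horth]
      simp
    rw [hform, Complex.add_re, h.re_form_self, h'.re_form_self, hnorm, mul_add]
    gcongr
    exacts [le_max_left .., le_max_right ..]

end Eigenvector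

/-- The space of `x` whose inclusion is orthogonal to that of `e`. When `e` is a constant function,
these are the functions of mean value zero. -/
def meanZero (e : W) : Submodule ℂ W := (innerSL ℂ (F.incl e) ∘L F.incl).ker

theorem mem_meanZero {e x : W} : x ∈ F.meanZero e ↔ ⟪F.incl e, F.incl x⟫_ℂ = 0 := Iff.rfl

theorem inner_incl_const_add {e x : W} (hx : x ∈ F.meanZero e) :
    ⟪F.incl e, F.incl (e + x)⟫_ℂ = (‖F.incl e‖ : ℂ) ^ 2 := by
  rw [map_add, inner_add_right, F.mem_meanZero.1 hx, add_zero, inner_self_eq_norm_sq_to_K]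
  rfl

instance [CompleteSpace W] (e : W) : CompleteSpace (F.meanZero e) :=
  (innerSL ℂ (F.incl e) ∘L F.incl).isClosed_ker.completeSpace_coe

/-- The structural properties of the operators of a Bloch problem in which `e` is a constant
function: derivatives of `e` vanish, derivatives have mean value zero, and the Laplacian is bounded
below on functions of mean value zero. -/
structure IsAdmissible (e : W) : Prop where
  nonneg : F.CoefNonneg
  symm : F.CoefSymm
  grad_const : ∀ j, F.grad j e = 0
  lap_const : F.lap e = 0
  const_ne : e ≠ 0
  injective : Function.Injective F.incl
  inner_grad : ∀ j w, ⟪F.incl e, F.grad j w⟫_ℂ = 0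
  inner_lap : ∀ w, ⟪F.incl e, F.lap w⟫_ℂ = 0
  exists_le_norm_lap : ∃ c > 0, ∀ x ∈ F.meanZero e, c * ‖x‖ ≤ ‖F.lap x‖

namespace IsAdmissible

variable {F} {e : W} (hF : F.IsAdmissible e)
include hF

theorem incl_ne_zero {w : W} (hw : w ≠ 0) : F.incl w ≠ 0 :=
  fun h => hw (hF.injective (h.trans (map_zero _).symm))

theorem exists_eq_smul_add (w : W) : ∃ a : ℂ, ∃ x ∈ F.meanZero e, w = a • e + x := by
  have he : ⟪F.incl e, F.incl e⟫_ℂ ≠ 0 := inner_self_ne_zero.2 (hF.incl_ne_zero hF.const_ne)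
  refine ⟨⟪F.incl e, F.incl w⟫_ℂ / ⟪F.incl e, F.incl e⟫_ℂ, _, ?_, (add_sub_cancel _ _).symm⟩
  rw [mem_meanZero, map_sub, map_smul, inner_sub_right, inner_smul_right, div_mul_cancel₀ _ he,
    sub_self]

theorem inner_lapOp {x : W} (hx : x ∈ F.meanZero e) (η : Fin d → ℝ) :
    ⟪F.incl e, F.lapOp η x⟫_ℂ = 0 := by
  simp [lapOp, hF.inner_grad, hF.inner_lap, F.mem_meanZero.1 hx]

theorem lapOp_const (η : Fin d → ℝ) : F.lapOp η e = -(∑ j, (η j : ℂ) ^ 2) • F.incl e := by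
  simp [lapOp, hF.lap_const, hF.grad_const]

theorem gradOp_const (η : Fin d → ℝ) (j : Fin d) :
    F.gradOp η j e = (Complex.I * (η j : ℂ)) • F.incl e := by
  simp [gradOp, hF.grad_const]

theorem flux_eq (η : Fin d → ℝ) (ε : ℝ) (χ : F.meanZero e) (j : Fin d) :
    (F.restrict _).flux (F.incl e) η ε χ j =
      ∑ k, F.coef j k (F.gradOp η k (e + (ε : ℂ) • (χ : W))) := by
  simp [flux, hF.gradOp_const, restrict, ← gradOp_restrict]

theorem const_add_ne_zero (x : F.meanZero e) : e + (x : W) ≠ 0 := fun h => by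
  have hmean := F.inner_incl_const_add x.2
  rw [h, map_zero, inner_zero_right, eq_comm, sq_eq_zero_iff] at hmean
  exact hF.incl_ne_zero hF.const_ne (by simpa using hmean)

section Corrector

variable [CompleteSpace W] [CompleteSpace K] {ρ ε : ℝ} (hρε : ρ ^ 2 * ε = 1) {η : Fin d → ℝ}
include hρε

omit [CompleteSpace W] [CompleteSpace K] in
theorem form_const (χ : F.meanZero e) :
    F.form ρ η (e + (ε : ℂ) • (χ : W)) e =
      (ρ : ℂ) ^ 2 * (F.restrict _).scaledEigenvalue (F.incl e) η ε χ *
        ⟪F.incl e, F.incl (e + (ε : ℂ) • (χ : W))⟫_ℂ := by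
  have hlap : ⟪F.lapOp η e, F.lapOp η (e + (ε : ℂ) • (χ : W))⟫_ℂ =
      (∑ j, (η j : ℂ) ^ 2) ^ 2 * (‖F.incl e‖ : ℂ) ^ 2 := by
    rw [map_add, map_smul, hF.lapOp_const, inner_add_right, inner_smul_left, inner_smul_right,
      inner_smul_right, inner_smul_left, hF.inner_lapOp χ.2, inner_self_eq_norm_sq_to_K]
    simp only [map_neg, map_sum, map_pow, Complex.conj_ofReal, Complex.coe_algebraMap]
    ring
  have hgrad : ∑ j, ⟪F.gradOp η j e, ∑ k, F.coef j k (F.gradOp η k (e + (ε : ℂ) • (χ : W)))⟫_ℂ =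
      ∑ j, ⟪(Complex.I * (η j : ℂ)) • F.incl e, (F.restrict _).flux (F.incl e) η ε χ j⟫_ℂ := by
    simp only [hF.flux_eq, hF.gradOp_const]
  have ho : (‖F.incl e‖ : ℂ) ≠ 0 := by simpa using hF.incl_ne_zero hF.const_ne
  have hρε' : (ρ : ℂ) ^ 2 * ε = 1 := mod_cast hρε
  rw [form, hlap, hgrad, scaledEigenvalue, F.inner_incl_const_add (Submodule.smul_mem _ _ χ.2)]
  push_cast
  field_simp
  linear_combination -(∑ j, ⟪(Complex.I * (η j : ℂ)) • F.incl e,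
    (F.restrict _).flux (F.incl e) η ε χ j⟫_ℂ) * hρε'

theorem form_meanZero {χ : F.meanZero e} (h : (F.restrict _).residual (F.incl e) η ε χ = 0)
    {x : W} (hx : x ∈ F.meanZero e) :
    F.form ρ η (e + (ε : ℂ) • (χ : W)) x =
      (ρ : ℂ) ^ 2 * (F.restrict _).scaledEigenvalue (F.incl e) η ε χ *
        ⟪F.incl x, F.incl (e + (ε : ℂ) • (χ : W))⟫_ℂ := by
  have hres := (F.restrict _).inner_residual (F.incl e) η ε χ ⟨x, hx⟩
  simp only [h, inner_zero_right, lapOp_restrict, gradOp_restrict, hF.flux_eq] at hres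
  have hincl : ⟪F.incl x, F.incl (e + (ε : ℂ) • (χ : W))⟫_ℂ = ε * ⟪F.incl x, F.incl χ⟫_ℂ := by
    rw [map_add, map_smul, inner_add_right, inner_smul_right,
      inner_eq_zero_symm.1 (F.mem_meanZero.1 hx), zero_add]
  have hlap : ⟪F.lapOp η x, F.lapOp η (e + (ε : ℂ) • (χ : W))⟫_ℂ =
      ε * ⟪F.lapOp η x, F.lapOp η χ⟫_ℂ := by
    rw [map_add, map_smul, hF.lapOp_const, inner_add_right, inner_smul_right, inner_smul_right,
      inner_eq_zero_symm.1 (hF.inner_lapOp hx η), mul_zero, zero_add]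
  have hρε' : (ρ : ℂ) ^ 2 * ε = 1 := mod_cast hρε
  rw [form, hincl, hlap]
  change 0 = _ + _ - _ * ⟪F.incl x, F.incl χ⟫_ℂ at hres
  linear_combination -hres + (⟪F.lapOp η x, F.lapOp η χ⟫_ℂ -
    (F.restrict _).scaledEigenvalue (F.incl e) η ε χ * ⟪F.incl x, F.incl χ⟫_ℂ) * hρε'

theorem form_eq_of_residual_eq_zero {χ : F.meanZero e}
    (h : (F.restrict _).residual (F.incl e) η ε χ = 0) (v : W) :
    F.form ρ η (e + (ε : ℂ) • (χ : W)) v =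
      (ρ : ℂ) ^ 2 * (F.restrict _).scaledEigenvalue (F.incl e) η ε χ *
        ⟪F.incl v, F.incl (e + (ε : ℂ) • (χ : W))⟫_ℂ := by
  obtain ⟨a, x, hx, rfl⟩ := hF.exists_eq_smul_add v
  rw [form_add_right, form_smul_right, hF.form_const hρε, hF.form_meanZero hρε h hx,
    map_add F.incl (a • e), map_smul, inner_add_left, inner_smul_left]
  ring

theorem isEigenvector_of_residual_eq_zero {χ : F.meanZero e}
    (h : (F.restrict _).residual (F.incl e) η ε χ = 0) :
    F.IsEigenvector ρ η (ρ ^ 2 * ((F.restrict _).scaledEigenvalue (F.incl e) η ε χ).re)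
      (e + (ε : ℂ) • (χ : W)) := by
  have hform := hF.form_eq_of_residual_eq_zero hρε h
  set φ := e + (ε : ℂ) • (χ : W)
  set μ := (F.restrict _).scaledEigenvalue (F.incl e) η ε χ
  have hφ : φ ≠ 0 := hF.const_add_ne_zero ((ε : ℂ) • χ)
  have hreal : conj ((ρ : ℂ) ^ 2 * μ) = (ρ : ℂ) ^ 2 * μ := by
    have hconj := form_conj ρ η hF.symm φ φ
    rw [hform φ, map_mul, inner_conj_symm] at hconj
    exact mul_right_cancel₀ (inner_self_ne_zero.2 (hF.incl_ne_zero hφ)) hconj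
  refine ⟨hφ, fun v => ?_⟩
  rw [hform v, ← Complex.conj_eq_iff_re.1 hreal, ← Complex.ofReal_pow, Complex.re_ofReal_mul]

end Corrector

theorem eventually_le_norm_lapOp : ∃ c > 0, ∀ᶠ η in 𝓝 (0 : Fin d → ℝ), ∀ x ∈ F.meanZero e,
    c * ‖x‖ ≤ ‖F.lapOp η x‖ := by
  obtain ⟨c, hc, hlap⟩ := hF.exists_le_norm_lap
  have hclose : Tendsto (fun η => ‖F.lapOp η - F.lap‖) (𝓝 0) (𝓝 0) := by
    simpa using (F.contDiff_lapOp.continuous.sub (continuous_const (y := F.lap))).norm.tendsto 0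
  refine ⟨c / 2, half_pos hc, ?_⟩
  filter_upwards [hclose.eventually (gt_mem_nhds (half_pos hc))] with η hη x hx
  calc c / 2 * ‖x‖ ≤ c * ‖x‖ - ‖F.lapOp η - F.lap‖ * ‖x‖ := by
        nlinarith [norm_nonneg x]
    _ ≤ ‖F.lap x‖ - ‖(F.lapOp η - F.lap) x‖ :=
        sub_le_sub (hlap x hx) ((F.lapOp η - F.lap).le_opNorm x)
    _ ≤ ‖F.lapOp η x‖ := by
        rw [sub_le_iff_le_add, sub_apply, norm_sub_rev]
        exact norm_le_insert' _ _

theorem exists_coercive : ∃ κ > 0, ∀ᶠ η in 𝓝 (0 : Fin d → ℝ), ∀ ρ : ℝ, 1 ≤ ρ →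
    ∀ x ∈ F.meanZero e, κ * ‖F.incl x‖ ^ 2 ≤ (F.form ρ η x x).re := by
  obtain ⟨c, hc, hlap⟩ := hF.eventually_le_norm_lapOp
  refine ⟨c ^ 2 / (‖F.incl‖ ^ 2 + 1), by positivity, ?_⟩
  filter_upwards [hlap] with η hη ρ hρ x hx
  have hincl : ‖F.incl x‖ ^ 2 ≤ (‖F.incl‖ ^ 2 + 1) * ‖x‖ ^ 2 := by
    nlinarith [pow_le_pow_left₀ (norm_nonneg _) (F.incl.le_opNorm x) 2, sq_nonneg ‖x‖]
  calc c ^ 2 / (‖F.incl‖ ^ 2 + 1) * ‖F.incl x‖ ^ 2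
      ≤ c ^ 2 / (‖F.incl‖ ^ 2 + 1) * ((‖F.incl‖ ^ 2 + 1) * ‖x‖ ^ 2) := by gcongr
    _ = (c * ‖x‖) ^ 2 := by field_simp
    _ ≤ ‖F.lapOp η x‖ ^ 2 := by gcongr; exact hη x hx
    _ ≤ ρ ^ 2 * ‖F.lapOp η x‖ ^ 2 :=
        le_mul_of_one_le_left (by positivity) (one_le_pow₀ hρ)
    _ ≤ (F.form ρ η x x).re := by
        rw [F.re_form_self]
        exact le_add_of_nonneg_left (hF.nonneg fun j => F.gradOp η j x)

section Uniqueness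

variable {ρ κ : ℝ} {η : Fin d → ℝ} {lam lam' : ℝ} {φ φ' : W}
  (hcoercive : ∀ x ∈ F.meanZero e, κ * ‖F.incl x‖ ^ 2 ≤ (F.form ρ η x x).re)
include hcoercive

theorem eq_zero_of_re_form_le {x : W} (hx : x ∈ F.meanZero e) (hlam : lam < κ)
    (h : (F.form ρ η x x).re ≤ lam * ‖F.incl x‖ ^ 2) : x = 0 := by
  by_contra hne
  have hpos : 0 < ‖F.incl x‖ := norm_pos_iff.2 (hF.incl_ne_zero hne)
  have hle := le_of_mul_le_mul_right ((hcoercive x hx).trans h) (by positivity)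
  exact absurd hle hlam.not_ge

theorem eigenvector_unique (hlam : lam < κ) (hlam' : lam' < κ) (h : F.IsEigenvector ρ η lam φ)
    (h' : F.IsEigenvector ρ η lam' φ') (hmean : φ - φ' ∈ F.meanZero e) :
    φ = φ' ∧ lam = lam' := by
  obtain rfl : φ = φ' := sub_eq_zero.1 <| hF.eq_zero_of_re_form_le hcoercive hmean
    (max_lt hlam hlam') (h.re_form_sub_le hF.symm h')
  have hpos : 0 < ‖F.incl φ‖ := norm_pos_iff.2 (hF.incl_ne_zero h.1)
  exact ⟨rfl, mul_right_cancel₀ (by positivity) (h.re_form_self.symm.trans h'.re_form_self)⟩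

theorem exists_eq_smul {x : F.meanZero e} (hlam : lam < κ) (hlam' : lam' < κ)
    (h : F.IsEigenvector ρ η lam (e + (x : W))) (h' : F.IsEigenvector ρ η lam' φ) :
    lam' = lam ∧ ∃ a : ℂ, φ = a • (e + (x : W)) := by
  obtain ⟨a, y, hy, rfl⟩ := hF.exists_eq_smul_add φ
  have ha : a ≠ 0 := by
    rintro rfl
    rw [zero_smul, zero_add] at h'
    exact h'.1 (hF.eq_zero_of_re_form_le hcoercive hy hlam' h'.re_form_self.le)
  have hscaled := h'.smul (inv_ne_zero ha)
  rw [smul_add, inv_smul_smul₀ ha] at hscaled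
  obtain ⟨heq, heq_lam⟩ := hF.eigenvector_unique hcoercive hlam' hlam hscaled h (by
    rw [add_sub_add_left_eq_sub]
    exact Submodule.sub_mem _ (Submodule.smul_mem _ _ hy) x.2)
  exact ⟨heq_lam, a, by rw [← heq, smul_add, smul_inv_smul₀ ha]⟩

theorem isLeast_eigenvalue {x : F.meanZero e} (hlam : lam < κ)
    (h : F.IsEigenvector ρ η lam (e + (x : W))) :
    IsLeast {lam' | ∃ φ, F.IsEigenvector ρ η lam' φ} lam := by
  refine ⟨⟨_, h⟩, fun lam' ⟨φ, hφ⟩ => ?_⟩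
  by_contra! hlt
  exact hlt.ne (hF.exists_eq_smul hcoercive hlam (hlt.trans hlam) h hφ).1

end Uniqueness

end IsAdmissible

end FormData

section MultiPartial

variable {d : ℕ} {E E' V V' : Type*} [NormedAddCommGroup E] [NormedSpace ℝ E]
  [NormedAddCommGroup E'] [NormedSpace ℝ E'] [NormedAddCommGroup V] [NormedSpace ℝ V]
  [NormedAddCommGroup V'] [NormedSpace ℝ V']

theorem foldr_fderiv_eq_iteratedFDeriv {ι : Type*} [CompleteSpace E] {f : V → E} {x : V}
    (hf : AnalyticAt ℝ f x) (v : ι → V) (l : List ι) :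
    ∀ᶠ y in 𝓝 x, l.foldr (fun j g y => fderiv ℝ g y (v j)) f y =
      iteratedFDeriv ℝ l.length f y fun i => v (l.get i) := by
  induction l with
  | nil => simp
  | cons j l ih =>
    filter_upwards [ih.eventually_nhds, hf.eventually_analyticAt] with y hy hfy
    have hdiff : DifferentiableAt ℝ (iteratedFDeriv ℝ l.length f) y :=
      hfy.contDiffAt.differentiableAt_iteratedFDeriv (WithTop.coe_lt_top _)
    rw [List.foldr_cons, EventuallyEq.fderiv_eq hy]
    exact (hdiff.iteratedFDeriv_succ_apply_left' (m := fun i => v ((j :: l).get i))).symm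

theorem iteratedFDeriv_comp_affine {f : V → E} (a : V) (g : V' →L[ℝ] V) {x : V'} {n : ℕ}
    (hf : ContDiffAt ℝ n f (a + g x)) :
    iteratedFDeriv ℝ n (fun z => f (a + g z)) x =
      (iteratedFDeriv ℝ n f (a + g x)).compContinuousLinearMap fun _ => g := by
  rw [← iteratedFDeriv_comp_add_left n a (g x)]
  have hshift : ContDiffAt ℝ n (fun z => f (a + z)) (g x) := by
    rw [← Function.comp_def]
    exact ContDiffAt.comp _ hf (by fun_prop)
  obtain ⟨u, hu, hxu, hfu⟩ := (contDiffWithinAt_univ.2 hshift).contDiffOn' le_rfl (by simp)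
  rw [Set.insert_eq_of_mem (Set.mem_univ _), Set.univ_inter] at hfu
  have hgu : IsOpen (g ⁻¹' u) := hu.preimage g.continuous
  rw [← iteratedFDerivWithin_of_isOpen n hu hxu,
    ← g.iteratedFDerivWithin_comp_right hfu hu.uniqueDiffOn hgu.uniqueDiffOn hxu le_rfl,
    iteratedFDerivWithin_of_isOpen n hgu hxu]
  rfl

theorem iteratedFDeriv_eq_zero_of_dilation {f : V → E} {t s : ℝ} {n : ℕ} (hf : ContDiffAt ℝ n f 0)
    (h : ∀ᶠ x in 𝓝 0, f (t • x) = s • f x) (hn : t ^ n ≠ s) : iteratedFDeriv ℝ n f 0 = 0 := by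
  have hdilate := iteratedFDeriv_comp_affine 0 (t • ContinuousLinearMap.id ℝ V) (x := 0) (n := n)
    (f := f) (by simpa using hf)
  have hscale : (fun x => f (0 + (t • ContinuousLinearMap.id ℝ V) x)) =ᶠ[𝓝 0] s • f := by
    filter_upwards [h] with x hx
    simpa using hx
  rw [(hscale.iteratedFDeriv ℝ n).self_of_nhds, iteratedFDeriv_const_smul_apply hf] at hdilate
  ext v
  have hv := congrArg (fun T => T v) hdilate
  simp only [smul_apply, map_zero, add_zero,
    ContinuousMultilinearMap.compContinuousLinearMap_apply, ContinuousLinearMap.id_apply,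
    ContinuousMultilinearMap.map_smul_univ, Finset.prod_const, Finset.card_univ,
    Fintype.card_fin] at hv
  rw [← sub_eq_zero, ← sub_smul] at hv
  exact (smul_eq_zero.1 hv).resolve_left (sub_ne_zero.2 hn.symm)

theorem exists_norm_iteratedFDeriv_slice_le [CompleteSpace E] {f : V × V' → E} {x : V} {y : V'}
    (hf : AnalyticAt ℝ f (x, y)) (n : ℕ) :
    ∃ C, ∀ᶠ z in 𝓝 y, ‖iteratedFDeriv ℝ n (fun v => f (v, z)) x‖ ≤ C := by
  set inl := ContinuousLinearMap.inl ℝ V V'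
  have hcont : ContinuousAt (fun z => iteratedFDeriv ℝ n f (x, z)) y :=
    (hf.contDiffAt.continuousAt_iteratedFDeriv (n := ω) le_top).comp' (by fun_prop)
  refine ⟨(‖iteratedFDeriv ℝ n f (x, y)‖ + 1) * ∏ _i : Fin n, ‖inl‖, ?_⟩
  filter_upwards [hcont.norm.eventually (ge_mem_nhds (lt_add_one _)),
    (Continuous.prodMk_right x).continuousAt.eventually hf.eventually_analyticAt] with z hz hfz
  have hslice := iteratedFDeriv_comp_affine (0, z) inl (x := x) (n := n) (f := f)
    (by simpa [inl] using hfz.contDiffAt)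
  simp only [inl, ContinuousLinearMap.inl_apply, Prod.mk_add_mk, zero_add, add_zero] at hslice
  rw [hslice]
  exact (ContinuousMultilinearMap.norm_compContinuousLinearMap_le _ _).trans (by gcongr)

/-- The coordinates, with repetitions, along which `∂^β` differentiates. -/
def indexList (β : Fin d → ℕ) : List (Fin d) :=
  (List.finRange d).flatMap fun j => List.replicate (β j) j

theorem length_indexList (β : Fin d → ℕ) : (indexList β).length = ∑ j, β j := by
  simp [indexList, List.length_flatMap, List.sum_ofFn, ← List.ofFn_eq_map]

theorem count_indexList (β : Fin d → ℕ) (j : Fin d) : (indexList β).count j = β j := by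
  have hcount : (List.count j ∘ fun k => List.replicate (β k) k) = fun k =>
      if k = j then β k else 0 := by
    ext k
    simp [List.count_replicate]
  simp [indexList, List.count_flatMap, hcount, ← List.ofFn_eq_map, List.sum_ofFn]

theorem indexList_unitIndex_add (j k : Fin d) :
    indexList (unitIndex j + unitIndex k) = [j, k] ∨
      indexList (unitIndex j + unitIndex k) = [k, j] := by
  rw [← List.perm_pair, List.perm_iff_count]
  intro i
  simp only [count_indexList, unitIndex, Pi.add_apply, Pi.single_apply, List.count_cons,
    List.count_nil, beq_iff_eq, eq_comm (a := i)]
  omega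

theorem multiPartial_eq_foldr (β : Fin d → ℕ) (f : (Fin d → ℝ) → E) :
    multiPartial β f = (indexList β).foldr partialEta f := by
  have hreplicate (j : Fin d) (n : ℕ) (g : (Fin d → ℝ) → E) :
      (List.replicate n j).foldr partialEta g = (partialEta j)^[n] g := by
    induction n with
    | zero => rfl
    | succ n ih => rw [List.replicate_succ, List.foldr_cons, ih, Function.iterate_succ_apply']
  simp only [multiPartial, indexList, List.foldr_flatMap, hreplicate]

theorem multiPartial_eq_iteratedFDeriv [CompleteSpace E] {f : (Fin d → ℝ) → E} {η : Fin d → ℝ}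
    (hf : AnalyticAt ℝ f η) (β : Fin d → ℕ) :
    multiPartial β f η = iteratedFDeriv ℝ (indexList β).length f η
      fun i => Pi.single ((indexList β).get i) 1 := by
  rw [multiPartial_eq_foldr]
  exact (foldr_fderiv_eq_iteratedFDeriv hf (fun j => Pi.single j 1) _).self_of_nhds

theorem multiPartial_congr [CompleteSpace E] {f g : (Fin d → ℝ) → E} {η : Fin d → ℝ}
    (hf : AnalyticAt ℝ f η) (h : f =ᶠ[𝓝 η] g) (β : Fin d → ℕ) :
    multiPartial β f η = multiPartial β g η := by
  rw [multiPartial_eq_iteratedFDeriv hf, multiPartial_eq_iteratedFDeriv (hf.congr h),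
    (h.iteratedFDeriv ℝ _).self_of_nhds]

theorem multiPartial_add [CompleteSpace E] {f g : (Fin d → ℝ) → E} {η : Fin d → ℝ}
    (hf : AnalyticAt ℝ f η) (hg : AnalyticAt ℝ g η) (β : Fin d → ℕ) :
    multiPartial β (f + g) η = multiPartial β f η + multiPartial β g η := by
  simp only [multiPartial_eq_iteratedFDeriv (hf.add hg), multiPartial_eq_iteratedFDeriv hf,
    multiPartial_eq_iteratedFDeriv hg, iteratedFDeriv_add_apply hf.contDiffAt hg.contDiffAt,
    add_apply]

theorem multiPartial_const_add [CompleteSpace E] {f : (Fin d → ℝ) → E} {η : Fin d → ℝ}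
    (hf : AnalyticAt ℝ f η) (a : E) {β : Fin d → ℕ} (hβ : ∑ j, β j ≠ 0) :
    multiPartial β (fun x => a + f x) η = multiPartial β f η := by
  rw [← length_indexList] at hβ
  have hconst : multiPartial β (fun _ => a) η = 0 := by
    rw [multiPartial_eq_iteratedFDeriv analyticAt_const, iteratedFDeriv_const_of_ne hβ]
    rfl
  exact (multiPartial_add analyticAt_const hf β).trans (by rw [hconst, zero_add])

theorem multiPartial_clm_comp [CompleteSpace E] [CompleteSpace E'] (T : E →L[ℝ] E')
    {f : (Fin d → ℝ) → E} {η : Fin d → ℝ} (hf : AnalyticAt ℝ f η) (β : Fin d → ℕ) :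
    multiPartial β (fun x => T (f x)) η = T (multiPartial β f η) := by
  have hTf : AnalyticAt ℝ (T ∘ f) η := (T.analyticAt _).comp hf
  rw [← Function.comp_def, multiPartial_eq_iteratedFDeriv hTf, multiPartial_eq_iteratedFDeriv hf,
    T.iteratedFDeriv_comp_left hf.contDiffAt le_rfl]
  rfl

theorem multiPartial_eq_zero_of_dilation [CompleteSpace E] {f : (Fin d → ℝ) → E}
    (hf : AnalyticAt ℝ f 0) {t s : ℝ} (h : ∀ᶠ η in 𝓝 0, f (t • η) = s • f η) {β : Fin d → ℕ}
    (hβ : t ^ ∑ j, β j ≠ s) : multiPartial β f 0 = 0 := by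
  rw [← length_indexList] at hβ
  rw [multiPartial_eq_iteratedFDeriv hf, iteratedFDeriv_eq_zero_of_dilation hf.contDiffAt h hβ]
  rfl

theorem exists_norm_multiPartial_slice_le [CompleteSpace E] {f : (Fin d → ℝ) × V → E}
    {η : Fin d → ℝ} {y : V} (hf : AnalyticAt ℝ f (η, y)) (β : Fin d → ℕ) :
    ∃ C, ∀ᶠ z in 𝓝 y, ‖multiPartial β (fun x => f (x, z)) η‖ ≤ C := by
  obtain ⟨C, hC⟩ := exists_norm_iteratedFDeriv_slice_le hf (indexList β).length
  refine ⟨C, ?_⟩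
  filter_upwards [hC,
    (Continuous.prodMk_right η).continuousAt.eventually hf.eventually_analyticAt] with z hz hfz
  have hslice : AnalyticAt ℝ (fun x => f (x, z)) η :=
    hfz.comp_of_eq (f := fun x => (x, z)) (by fun_prop) rfl
  rw [multiPartial_eq_iteratedFDeriv hslice]
  refine (ContinuousMultilinearMap.le_of_opNorm_le hz _).trans_eq ?_
  simp [Pi.norm_single]

theorem partialEta_quadratic (m : Fin d → Fin d → ℝ) (k : Fin d) :
    partialEta k (fun η => ∑ a, ∑ b, (η a * η b) * m a b) =
      fun η => ∑ a, (m a k + m k a) * η a := by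
  have hderiv (η : Fin d → ℝ) : HasFDerivAt (fun η : Fin d → ℝ => ∑ a, ∑ b, (η a * η b) * m a b)
      (∑ a, ∑ b, m a b • (η a • ContinuousLinearMap.proj (R := ℝ) (φ := fun _ : Fin d => ℝ) b +
        η b • ContinuousLinearMap.proj a)) η :=
    HasFDerivAt.fun_sum fun a _ => HasFDerivAt.fun_sum fun b _ =>
      ((hasFDerivAt_apply a η).mul (hasFDerivAt_apply b η)).mul_const _
  funext η
  rw [partialEta, (hderiv η).fderiv]
  simp [Pi.single_apply, Finset.sum_add_distrib, add_mul]

theorem partialEta_linear (c : Fin d → ℝ) (j : Fin d) :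
    partialEta j (fun η => ∑ a, c a * η a) = fun _ => c j := by
  have hderiv (η : Fin d → ℝ) : HasFDerivAt (fun η : Fin d → ℝ => ∑ a, c a * η a)
      (∑ a, c a • ContinuousLinearMap.proj (R := ℝ) (φ := fun _ : Fin d => ℝ) a) η :=
    HasFDerivAt.fun_sum fun a _ => (hasFDerivAt_apply a η).const_mul _
  funext η
  rw [partialEta, (hderiv η).fderiv]
  simp [Pi.single_apply]

theorem multiPartial_pair_quadratic (m : Fin d → Fin d → ℝ) (j k : Fin d) (η : Fin d → ℝ) :
    multiPartial (unitIndex j + unitIndex k) (fun η => ∑ a, ∑ b, (η a * η b) * m a b) η =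
      m j k + m k j := by
  rw [multiPartial_eq_foldr]
  rcases indexList_unitIndex_add j k with h | h
  · simp only [h, List.foldr_cons, List.foldr_nil, partialEta_quadratic, partialEta_linear]
  · simp only [h, List.foldr_cons, List.foldr_nil, partialEta_quadratic, partialEta_linear,
      add_comm]

end MultiPartial

/-- A bound that holds locally uniformly in `ε = ρ⁻² ∈ [0, 1]`, the limit `ε = 0` included, holds
uniformly in `ρ ≥ 1`. -/
theorem exists_forall_le_of_locally {P : ℝ → ℝ → Prop} (hP : ∀ ρ, Monotone (P ρ))
    (h : ∀ ε₀ ∈ Set.Icc (0 : ℝ) 1,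
      ∃ C, ∀ᶠ ε in 𝓝 ε₀, ∀ ρ : ℝ, 1 ≤ ρ → (ρ ^ 2)⁻¹ = ε → P ρ C) :
    ∃ C, ∀ ρ : ℝ, 1 ≤ ρ → P ρ C := by
  suffices hIcc : ∃ C, ∀ ε ∈ Set.Icc (0 : ℝ) 1, ∀ ρ : ℝ, 1 ≤ ρ → (ρ ^ 2)⁻¹ = ε → P ρ C by
    obtain ⟨C, hC⟩ := hIcc
    exact ⟨C, fun ρ hρ => hC _ ⟨by positivity, inv_le_one_of_one_le₀ (one_le_pow₀ hρ)⟩ ρ hρ rfl⟩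
  refine isCompact_Icc.induction_on
    (p := fun s => ∃ C, ∀ ε ∈ s, ∀ ρ : ℝ, 1 ≤ ρ → (ρ ^ 2)⁻¹ = ε → P ρ C) ⟨0, by simp⟩ ?_ ?_ ?_
  · exact fun s t hst ⟨C, hC⟩ => ⟨C, fun ε hε => hC ε (hst hε)⟩
  · rintro s t ⟨C, hC⟩ ⟨C', hC'⟩
    refine ⟨max C C', ?_⟩
    rintro ε (hε | hε) ρ hρ hρε
    · exact hP ρ (le_max_left _ _) (hC ε hε ρ hρ hρε)
    · exact hP ρ (le_max_right _ _) (hC' ε hε ρ hρ hρε)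
  · intro ε₀ hε₀
    obtain ⟨C, hC⟩ := h ε₀ hε₀
    exact ⟨_, mem_nhdsWithin_of_mem_nhds hC, C, fun ε hε => hε⟩

section Fourier

variable {d : ℕ}

instance : IsFiniteMeasure (muY d) := by
  refine ⟨?_⟩
  rw [Measure.restrict_apply_univ, cellY, volume_pi_pi]
  exact ENNReal.prod_lt_top fun j _ => by simp [ENNReal.mul_lt_top]

/-- The volume `|Y| = (2π)^d` of the cell. -/
def cellVolume (d : ℕ) : ℝ := (2 * Real.pi) ^ d

theorem cellVolume_pos (d : ℕ) : 0 < cellVolume d := by unfold cellVolume; positivity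

theorem volume_real_cellY : (volume : Measure (Fin d → ℝ)).real (cellY d) = cellVolume d := by
  simp [Measure.real, cellY, volume_pi_pi, cellVolume, Real.pi_pos.le]

theorem norm_expY (n : Fin d → ℤ) (y : Fin d → ℝ) : ‖expY n y‖ = 1 := by
  simp [expY, Complex.norm_exp]

theorem continuous_expY (n : Fin d → ℤ) : Continuous (expY n) := by unfold expY; fun_prop

theorem expY_zero (y : Fin d → ℝ) : expY 0 y = 1 := by simp [expY]

theorem expY_mul_conj (n m : Fin d → ℤ) (y : Fin d → ℝ) :
    expY m y * conj (expY n y) = expY (m - n) y := by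
  simp only [expY, ← Complex.exp_conj, ← Complex.exp_add, map_mul, Complex.conj_I, map_sum,
    Complex.conj_ofReal, Pi.sub_apply, Int.cast_sub, sub_mul, Finset.sum_sub_distrib, map_intCast]
  ring_nf

theorem conj_expY (n : Fin d → ℤ) (y : Fin d → ℝ) : conj (expY n y) = expY (-n) y := by
  have h := expY_mul_conj n 0 y
  rwa [expY_zero, one_mul, zero_sub] at h

theorem integral_expY_of_ne {n : Fin d → ℤ} (hn : n ≠ 0) : ∫ y in cellY d, expY n y = 0 := by
  obtain ⟨j, hj⟩ := Function.ne_iff.1 hn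
  have hprod : expY n = fun y : Fin d → ℝ => ∏ j, Complex.exp (Complex.I * n j * y j) := by
    funext y
    simp [expY, Finset.mul_sum, Complex.exp_sum, mul_assoc]
  have hcell : muY d = Measure.pi fun _ => volume.restrict (Set.Ico 0 (2 * Real.pi)) :=
    Measure.restrict_pi_pi _ _
  have hperiod : Complex.exp (Complex.I * n j * ((2 * Real.pi : ℝ) : ℂ)) = 1 :=
    Complex.exp_eq_one_iff.2 ⟨n j, by push_cast; ring⟩
  change ∫ y, expY n y ∂(muY d) = 0
  rw [hcell, hprod,
    integral_fintype_prod_eq_prod (f := fun j (t : ℝ) => Complex.exp (Complex.I * n j * t))]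
  refine Finset.prod_eq_zero (Finset.mem_univ j) ?_
  rw [integral_Ico_eq_integral_Ioc, ← intervalIntegral.integral_of_le (by positivity),
    integral_exp_mul_complex (by simpa using hj), hperiod]
  simp

theorem integral_expY (n : Fin d → ℤ) :
    ∫ y in cellY d, expY n y = if n = 0 then (cellVolume d : ℂ) else 0 := by
  split_ifs with hn
  · simp [hn, expY_zero, volume_real_cellY]
  · exact integral_expY_of_ne hn

/-- The character `e^{i n·y}` as an element of `L²_♯(Y)`. -/
def expL2 (n : Fin d → ℤ) : L2Y d :=
  (MemLp.of_bound (continuous_expY n).aestronglyMeasurable 1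
    (Eventually.of_forall fun y => (norm_expY n y).le) : MemLp (expY n) 2 (muY d)).toLp _

theorem coeFn_expL2 (n : Fin d → ℤ) : expL2 n =ᵐ[muY d] expY n := MemLp.coeFn_toLp _

theorem inner_expL2 (n : Fin d → ℤ) (u : L2Y d) : ⟪expL2 n, u⟫_ℂ = cellVolume d * fourierY u n := by
  have hcongr : ∫ y, ⟪expL2 n y, u y⟫_ℂ ∂(muY d) = ∫ y in cellY d, u y * conj (expY n y) := by
    refine integral_congr_ae ?_
    filter_upwards [coeFn_expL2 n] with y hy
    rw [hy, RCLike.inner_apply]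
  rw [L2.inner_def, hcongr, fourierY, meanY, ← cellVolume, Complex.real_smul, Complex.ofReal_inv,
    mul_inv_cancel_left₀ (Complex.ofReal_ne_zero.2 (cellVolume_pos d).ne')]

theorem inner_expL2_expL2 (n m : Fin d → ℤ) :
    ⟪(expL2 n : L2Y d), expL2 m⟫_ℂ = if n = m then (cellVolume d : ℂ) else 0 := by
  have hcongr : ∫ y, ⟪expL2 n y, expL2 m y⟫_ℂ ∂(muY d) = ∫ y in cellY d, expY (m - n) y := by
    refine integral_congr_ae ?_
    filter_upwards [coeFn_expL2 n, coeFn_expL2 m] with y hn hm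
    rw [hn, hm, RCLike.inner_apply, expY_mul_conj]
  rw [L2.inner_def, hcongr, integral_expY]
  simp only [sub_eq_zero, eq_comm]

theorem fourierY_expL2 (n m : Fin d → ℤ) : fourierY (expL2 m) n = if n = m then 1 else 0 := by
  have h := inner_expL2 n (expL2 m)
  rw [inner_expL2_expL2] at h
  have hv : (cellVolume d : ℂ) ≠ 0 := Complex.ofReal_ne_zero.2 (cellVolume_pos d).ne'
  split_ifs at h ⊢
  · exact (mul_eq_left₀ hv).1 h.symm
  · simpa [hv] using h.symm

theorem ofReal_sqrt_cellVolume_ne_zero (d : ℕ) : (√(cellVolume d) : ℂ) ≠ 0 :=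
  Complex.ofReal_ne_zero.2 (Real.sqrt_pos.2 (cellVolume_pos d)).ne'

theorem ofReal_cellVolume_eq (d : ℕ) :
    (cellVolume d : ℂ) = √(cellVolume d) * √(cellVolume d) := by
  exact_mod_cast (Real.mul_self_sqrt (cellVolume_pos d).le).symm

theorem orthonormal_smul_expL2 (d : ℕ) :
    Orthonormal ℂ fun n : Fin d → ℤ => (√(cellVolume d) : ℂ)⁻¹ • (expL2 n : L2Y d) := by
  rw [orthonormal_iff_ite]
  intro n m
  rw [inner_smul_left, inner_smul_right, inner_expL2_expL2, ofReal_cellVolume_eq]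
  have hv := ofReal_sqrt_cellVolume_ne_zero d
  split_ifs
  · rw [map_inv₀, Complex.conj_ofReal, inv_mul_cancel_left₀ hv, inv_mul_cancel₀ hv]
  · simp

theorem span_smul_expL2_orthogonal (d : ℕ) :
    (Submodule.span ℂ (Set.range fun n : Fin d → ℤ =>
      (√(cellVolume d) : ℂ)⁻¹ • (expL2 n : L2Y d)))ᗮ = ⊥ := by
  refine (Submodule.eq_bot_iff _).2 fun u hu => eq_zero_of_fourierY u fun n => ?_
  have h := (Submodule.mem_orthogonal _ _).1 hu _ (Submodule.subset_span ⟨n, rfl⟩)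
  rw [inner_smul_left, inner_expL2, mul_eq_zero_iff_left, mul_eq_zero_iff_left] at h
  · exact h
  · exact Complex.ofReal_ne_zero.2 (cellVolume_pos d).ne'
  · simpa using ofReal_sqrt_cellVolume_ne_zero d

/-- The normalised characters `|Y|^{-1/2} e^{i n·y}`. -/
def fourierBasis (d : ℕ) : HilbertBasis (Fin d → ℤ) ℂ (L2Y d) :=
  .mkOfOrthogonalEqBot (orthonormal_smul_expL2 d) (span_smul_expL2_orthogonal d)

theorem fourierBasis_repr (u : L2Y d) (n : Fin d → ℤ) :
    (fourierBasis d).repr u n = √(cellVolume d) * fourierY u n := by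
  rw [HilbertBasis.repr_apply_apply, fourierBasis, HilbertBasis.coe_mkOfOrthogonalEqBot,
    inner_smul_left, inner_expL2, map_inv₀, Complex.conj_ofReal, ofReal_cellVolume_eq, mul_assoc,
    inv_mul_cancel_left₀ (ofReal_sqrt_cellVolume_ne_zero d)]

theorem fourierY_eq_inner (n : Fin d → ℤ) (u : L2Y d) :
    fourierY u n = (cellVolume d : ℂ)⁻¹ * ⟪expL2 n, u⟫_ℂ := by
  rw [inner_expL2, inv_mul_cancel_left₀ (Complex.ofReal_ne_zero.2 (cellVolume_pos d).ne')]

theorem fourierY_zero (n : Fin d → ℤ) : fourierY (0 : L2Y d) n = 0 := by simp [fourierY_eq_inner]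

theorem fourierY_sum {ι : Type*} (s : Finset ι) (u : ι → L2Y d) (n : Fin d → ℤ) :
    fourierY (∑ i ∈ s, u i) n = ∑ i ∈ s, fourierY (u i) n := by
  simp only [fourierY_eq_inner, inner_sum, Finset.mul_sum]

theorem fourierY_ext {u v : L2Y d} (h : ∀ n, fourierY u n = fourierY v n) : u = v :=
  sub_eq_zero.1 <| eq_zero_of_fourierY _ fun n => by
    rw [fourierY_eq_inner, inner_sub_right, mul_sub, ← fourierY_eq_inner, ← fourierY_eq_inner, h,
      sub_self]

theorem hasSum_norm_sq (u : L2Y d) :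
    HasSum (fun n => cellVolume d * ‖fourierY u n‖ ^ 2) (‖u‖ ^ 2) := by
  have h := lp.hasSum_norm (by norm_num) ((fourierBasis d).repr u)
  simpa [fourierBasis_repr, mul_pow, Real.sq_sqrt (cellVolume_pos d).le] using h

/-- Fourier synthesis: the function in `L²_♯(Y)` with given square summable Fourier
coefficients. -/
def synthesis (d : ℕ) : lp (fun _ : Fin d → ℤ => ℂ) 2 →L[ℂ] L2Y d :=
  (√(cellVolume d) : ℂ) • ((fourierBasis d).repr.symm : _ →L[ℂ] L2Y d)

theorem fourierY_synthesis (a : lp (fun _ : Fin d → ℤ => ℂ) 2) (n : Fin d → ℤ) :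
    fourierY (synthesis d a) n = a n := by
  have h := fourierBasis_repr ((fourierBasis d).repr.symm a) n
  rw [LinearIsometryEquiv.apply_symm_apply] at h
  exact (fourierY_smul _ _ n).trans h.symm

end Fourier

section PeriodicSobolev

variable {d s : ℕ}

instance : InnerProductSpace ℂ (HY d s) where
  inner u v := ⟪HY.toSeq u, HY.toSeq v⟫_ℂ
  norm_sq_eq_re_inner u := norm_sq_eq_re_inner (𝕜 := ℂ) (HY.toSeq u)
  conj_inner_symm u v := inner_conj_symm (HY.toSeq u) (HY.toSeq v)
  add_left u v w := by simp
  smul_left u v r := by simp [mul_comm]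

theorem HY.toSeq_apply (u : HY d s) (n : Fin d → ℤ) :
    HY.toSeq u n = √(sobolevWeight s n) * fourierY (HY.toL2 u) n := rfl

theorem HY.toL2_injective : Function.Injective (HY.toL2 (d := d) (s := s)) :=
  Subtype.val_injective

theorem HY.hasSum_norm_sq (u : HY d s) :
    HasSum (fun n => sobolevWeight s n * ‖fourierY (HY.toL2 u) n‖ ^ 2) (‖u‖ ^ 2) := by
  have h := lp.hasSum_norm (by norm_num) (HY.toSeq u)
  simp only [HY.toSeq_apply, norm_mul, Complex.norm_real, Real.norm_of_nonneg (Real.sqrt_nonneg _),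
    ENNReal.toReal_ofNat, Real.rpow_ofNat, mul_pow, Real.sq_sqrt (sobolevWeight_pos s _).le] at h
  exact h

theorem ofReal_sqrt_sobolevWeight_ne_zero (s : ℕ) (n : Fin d → ℤ) :
    (√(sobolevWeight s n) : ℂ) ≠ 0 :=
  Complex.ofReal_ne_zero.2 (Real.sqrt_pos.2 (sobolevWeight_pos s n)).ne'

theorem one_le_sobolevWeight (s : ℕ) (n : Fin d → ℤ) : 1 ≤ sobolevWeight s n :=
  one_le_pow₀ (le_add_of_nonneg_right (Finset.sum_nonneg fun _ _ => sq_nonneg _))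

/-- The operator on `ℓ²(ℤᵈ)` that turns `H^s`-weighted Fourier coefficients `(1+|n|²)^{s/2} û(n)`
into the coefficients `m(n) û(n)`. -/
def weightedMultiplier (m : (Fin d → ℤ) → ℂ) (hm : ∀ n, ‖m n‖ ≤ √(sobolevWeight s n)) :
    lp (fun _ : Fin d → ℤ => ℂ) 2 →L[ℂ] lp (fun _ : Fin d → ℤ => ℂ) 2 :=
  lp.mapCLM 2 (fun n => (m n / √(sobolevWeight s n)) • ContinuousLinearMap.id ℂ ℂ) zero_le_one
    fun n => by
      rw [norm_smul, norm_div, Complex.norm_real, Real.norm_of_nonneg (Real.sqrt_nonneg _)]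
      simpa using div_le_one_of_le₀ (hm n) (Real.sqrt_nonneg _)

theorem fourierY_synthesis_weightedMultiplier {m : (Fin d → ℤ) → ℂ}
    (hm : ∀ n, ‖m n‖ ≤ √(sobolevWeight s n)) (a : lp (fun _ : Fin d → ℤ => ℂ) 2)
    (n : Fin d → ℤ) :
    fourierY (synthesis d (weightedMultiplier m hm a)) n = m n / √(sobolevWeight s n) * a n := by
  rw [fourierY_synthesis]
  rfl

theorem HY.toSeq_surjective : Function.Surjective (HY.toSeq (d := d) (s := s)) := by
  intro a
  have hm : ∀ n : Fin d → ℤ, ‖(fun _ => 1 : (Fin d → ℤ) → ℂ) n‖ ≤ √(sobolevWeight s n) := by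
    simpa using one_le_sobolevWeight s
  set u := synthesis d (weightedMultiplier _ hm a)
  have hu (n : Fin d → ℤ) : √(sobolevWeight s n) * fourierY u n = a n := by
    rw [fourierY_synthesis_weightedMultiplier, one_div,
      mul_inv_cancel_left₀ (ofReal_sqrt_sobolevWeight_ne_zero s n)]
  have husum : Summable fun n => sobolevWeight s n * ‖fourierY u n‖ ^ 2 := by
    have ha := (lp.hasSum_norm (by norm_num) a).summable
    simpa [← hu, mul_pow, Real.sq_sqrt (sobolevWeight_pos s _).le] using ha
  exact ⟨⟨u, husum⟩, lp.ext (funext hu)⟩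

/-- `H^s_♯(Y)` is isometric to `ℓ²(ℤᵈ)` through the weighted Fourier coefficients. -/
def HY.equivSeq (d s : ℕ) : HY d s ≃ₗᵢ[ℂ] lp (fun _ : Fin d → ℤ => ℂ) 2 where
  toLinearEquiv := LinearEquiv.ofBijective HY.toSeq ⟨HY.toSeq_injective, HY.toSeq_surjective⟩
  norm_map' _ := rfl

instance : CompleteSpace (HY d s) := (HY.equivSeq d s).toIsometryEquiv.completeSpace

/-- The Fourier multiplier with symbol `m`, of order at most `s`, from `H^s_♯(Y)` to `L²_♯(Y)`. -/
def multiplier (m : (Fin d → ℤ) → ℂ) (hm : ∀ n, ‖m n‖ ≤ √(sobolevWeight s n)) :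
    HY d s →L[ℂ] L2Y d :=
  synthesis d ∘L weightedMultiplier m hm ∘L (HY.equivSeq d s : HY d s →L[ℂ] _)

theorem fourierY_multiplier {m : (Fin d → ℤ) → ℂ} (hm : ∀ n, ‖m n‖ ≤ √(sobolevWeight s n))
    (u : HY d s) (n : Fin d → ℤ) :
    fourierY (multiplier m hm u) n = m n * fourierY (HY.toL2 u) n := by
  refine (fourierY_synthesis_weightedMultiplier hm (HY.toSeq u) n).trans ?_
  rw [HY.toSeq_apply, ← mul_assoc, div_mul_cancel₀ _ (ofReal_sqrt_sobolevWeight_ne_zero s n)]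

end PeriodicSobolev

section Operators

variable {d : ℕ}

theorem pderivY_eq {j : Fin d} {u g : L2Y d}
    (h : ∀ n, fourierY g n = Complex.I * n j * fourierY u n) : pderivY j u = g := by
  have hex : ∃ g : L2Y d, ∀ n, fourierY g n = Complex.I * n j * fourierY u n := ⟨g, h⟩
  rw [pderivY, dif_pos hex]
  exact fourierY_ext fun n => by rw [hex.choose_spec, h]

theorem sq_le_sum_sq (n : Fin d → ℤ) (j : Fin d) : (n j : ℝ) ^ 2 ≤ ∑ i, (n i : ℝ) ^ 2 :=
  Finset.single_le_sum (f := fun i => (n i : ℝ) ^ 2) (fun _ _ => sq_nonneg _) (Finset.mem_univ j)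

theorem norm_neg_sum_sq (n : Fin d → ℤ) : ‖-∑ j, (n j : ℂ) ^ 2‖ = ∑ j, (n j : ℝ) ^ 2 := by
  have hcast : ∑ j, (n j : ℂ) ^ 2 = ((∑ j, (n j : ℝ) ^ 2 : ℝ) : ℂ) := by push_cast; rfl
  rw [norm_neg, hcast, Complex.norm_real,
    Real.norm_of_nonneg (Finset.sum_nonneg fun _ _ => sq_nonneg _)]

theorem sqrt_sobolevWeight_two (n : Fin d → ℤ) :
    √(sobolevWeight 2 n) = 1 + ∑ j, (n j : ℝ) ^ 2 :=
  Real.sqrt_sq (add_nonneg zero_le_one (Finset.sum_nonneg fun _ _ => sq_nonneg _))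

namespace HY

/-- The continuous inclusion of `H^s_♯(Y)` in `L²_♯(Y)`. -/
def embed (d s : ℕ) : HY d s →L[ℂ] L2Y d :=
  multiplier (fun _ => 1) fun n => by simpa using one_le_sobolevWeight s n

/-- The partial derivative `∂_j : H²_♯(Y) → L²_♯(Y)`. -/
def pderiv (j : Fin d) : HY d 2 →L[ℂ] L2Y d :=
  multiplier (fun n => Complex.I * n j) fun n => by
    rw [sqrt_sobolevWeight_two, norm_mul, Complex.norm_I, one_mul, Complex.norm_intCast]
    nlinarith [sq_le_sum_sq n j, sq_abs (n j : ℝ)]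

/-- The second partial derivative `∂_j² : H²_♯(Y) → L²_♯(Y)`. -/
def pderivSq (j : Fin d) : HY d 2 →L[ℂ] L2Y d :=
  multiplier (fun n => -(n j : ℂ) ^ 2) fun n => by
    rw [sqrt_sobolevWeight_two, norm_neg, norm_pow, Complex.norm_intCast, sq_abs]
    linarith [sq_le_sum_sq n j]

/-- The Laplacian `Δ : H²_♯(Y) → L²_♯(Y)`. -/
def laplacian (d : ℕ) : HY d 2 →L[ℂ] L2Y d :=
  multiplier (fun n => -∑ j, (n j : ℂ) ^ 2) fun n => by
    rw [sqrt_sobolevWeight_two, norm_neg_sum_sq]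
    linarith

theorem embed_apply {s : ℕ} (u : HY d s) : embed d s u = toL2 u :=
  fourierY_ext fun n => by rw [embed, fourierY_multiplier, one_mul]

theorem pderivY_toL2 (j : Fin d) (u : HY d 2) : pderivY j (toL2 u) = pderiv j u :=
  pderivY_eq fun n => by rw [pderiv, fourierY_multiplier]

theorem pderivY_pderiv_add_smul (j : Fin d) (u : HY d 2) (c : ℂ) :
    pderivY j (pderiv j u + c • toL2 u) = pderivSq j u + c • pderiv j u :=
  pderivY_eq fun n => by
    simp only [pderiv, pderivSq, fourierY_add, fourierY_smul, fourierY_multiplier]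
    linear_combination -(n j : ℂ) ^ 2 * fourierY (toL2 u) n * Complex.I_sq

theorem shiftGrad_toL2 (η : Fin d → ℝ) (j : Fin d) (u : HY d 2) :
    shiftGrad η j (toL2 u) = pderiv j u + (Complex.I * η j : ℂ) • toL2 u := by
  rw [shiftGrad, pderivY_toL2]

theorem shiftGrad_shiftGrad_toL2 (η : Fin d → ℝ) (j : Fin d) (u : HY d 2) :
    shiftGrad η j (shiftGrad η j (toL2 u)) =
      pderivSq j u + (2 * Complex.I * η j : ℂ) • pderiv j u - ((η j : ℂ) ^ 2) • toL2 u := by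
  have hsq : (Complex.I * η j : ℂ) * (Complex.I * η j) = -(η j : ℂ) ^ 2 := by
    linear_combination (η j : ℂ) ^ 2 * Complex.I_sq
  rw [shiftGrad_toL2, shiftGrad, pderivY_pderiv_add_smul, smul_add, smul_smul, hsq]
  module

theorem sum_pderivSq (u : HY d 2) : ∑ j, pderivSq j u = laplacian d u :=
  fourierY_ext fun n => by
    simp only [fourierY_sum, laplacian, pderivSq, fourierY_multiplier, ← Finset.sum_mul,
      Finset.sum_neg_distrib]

theorem shiftLaplacian_toL2 (η : Fin d → ℝ) (u : HY d 2) :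
    shiftLaplacian η (toL2 u) = laplacian d u +
      ∑ j, (2 * Complex.I * η j : ℂ) • pderiv j u - (∑ j, (η j : ℂ) ^ 2) • toL2 u := by
  simp only [shiftLaplacian, shiftGrad_shiftGrad_toL2, Finset.sum_sub_distrib,
    Finset.sum_add_distrib, sum_pderivSq, Finset.sum_smul]

/-- The constant function `1` in `H²_♯(Y)`. -/
def one (d : ℕ) : HY d 2 :=
  ⟨expL2 0, summable_of_ne_finset_zero (s := {0}) fun n hn => by
    rw [fourierY_expL2, if_neg (Finset.notMem_singleton.1 hn), norm_zero, zero_pow two_ne_zero,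
      mul_zero]⟩

theorem toL2_one : toL2 (one d) = expL2 0 := rfl

theorem embed_one : embed d 2 (one d) = expL2 0 := embed_apply _

theorem one_ne_zero : one d ≠ 0 := fun h => by
  have hcoeff := fourierY_expL2 (0 : Fin d → ℤ) 0
  rw [← toL2_one, h, map_zero, fourierY_zero, if_pos rfl] at hcoeff
  exact zero_ne_one hcoeff

theorem pderiv_one (j : Fin d) : pderiv j (one d) = 0 := fourierY_ext fun n => by
  rw [pderiv, fourierY_multiplier, toL2_one, fourierY_expL2, fourierY_zero]
  split_ifs with hn <;> simp [hn]

theorem laplacian_one : laplacian d (one d) = 0 := fourierY_ext fun n => by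
  rw [laplacian, fourierY_multiplier, toL2_one, fourierY_expL2, fourierY_zero]
  split_ifs with hn <;> simp [hn]

theorem inner_expL2_zero_pderiv (j : Fin d) (u : HY d 2) : ⟪expL2 0, pderiv j u⟫_ℂ = 0 := by
  simp [inner_expL2, pderiv, fourierY_multiplier]

theorem inner_expL2_zero_laplacian (u : HY d 2) : ⟪expL2 0, laplacian d u⟫_ℂ = 0 := by
  simp [inner_expL2, laplacian, fourierY_multiplier]

theorem norm_le_norm_laplacian {u : HY d 2} (hu : fourierY (toL2 u) 0 = 0) :
    √(cellVolume d) / 2 * ‖u‖ ≤ ‖laplacian d u‖ := by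
  have hvol := cellVolume_pos d
  refine (sq_le_sq₀ (by positivity) (norm_nonneg _)).1 ?_
  rw [mul_pow, div_pow, Real.sq_sqrt hvol.le]
  refine hasSum_le (fun n => ?_) (u.hasSum_norm_sq.mul_left _)
    (BlochWave.hasSum_norm_sq _)
  rcases eq_or_ne n 0 with rfl | hn
  · rw [hu, norm_zero, zero_pow two_ne_zero, mul_zero, mul_zero]
    positivity
  have hone : 1 ≤ ∑ j, (n j : ℝ) ^ 2 := by
    obtain ⟨j, hj⟩ := Function.ne_iff.1 hn
    have hj' : (1 : ℤ) ≤ n j ^ 2 := Order.one_le_iff_pos.2 (sq_pos_of_ne_zero hj)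
    exact le_trans (mod_cast hj') (sq_le_sum_sq n j)
  have hweight : sobolevWeight 2 n / 2 ^ 2 ≤ (∑ j, (n j : ℝ) ^ 2) ^ 2 := by
    rw [sobolevWeight, ← div_pow]
    gcongr
    linarith
  rw [laplacian, fourierY_multiplier, norm_mul, mul_pow, norm_neg_sum_sq]
  calc cellVolume d / 2 ^ 2 * (sobolevWeight 2 n * ‖fourierY (toL2 u) n‖ ^ 2)
      = cellVolume d * (sobolevWeight 2 n / 2 ^ 2 * ‖fourierY (toL2 u) n‖ ^ 2) := by ring
    _ ≤ _ := by gcongr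

end HY

end Operators

/-- Multiplication by a function in `L^∞`. -/
def linftyMul {d : ℕ} {a : (Fin d → ℝ) → ℂ} (ha : MemLp a ∞ (muY d)) : L2Y d →L[ℂ] L2Y d :=
  (ContinuousLinearMap.mul ℂ ℂ).holderL (muY d) ∞ 2 2 ha.toLp

theorem coeFn_linftyMul {d : ℕ} {a : (Fin d → ℝ) → ℂ} (ha : MemLp a ∞ (muY d)) (u : L2Y d) :
    linftyMul ha u =ᵐ[muY d] fun y => a y * u y := by
  have h := (ContinuousLinearMap.mul ℂ ℂ).coeFn_holder (r := 2) ha.toLp u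
  filter_upwards [h, ha.coeFn_toLp] with y hmul ha_y
  rwa [ha_y] at hmul

section Coefficients

variable {d : ℕ} {A : (Fin d → ℝ) → Matrix (Fin d) (Fin d) ℝ}

/-- The coefficients are bounded and measurable on the cell, with positive semidefinite (possibly
degenerate) values: the biharmonic term alone makes the Bloch problem elliptic. -/
structure IsBoundedPosSemidef (A : (Fin d → ℝ) → Matrix (Fin d) (Fin d) ℝ) : Prop where
  memLp : ∀ j k, MemLp (fun y => A y j k) ∞ (muY d)
  posSemidef : ∀ᵐ y ∂muY d, (A y).PosSemidef

theorem IsPeriodicElliptic.isBoundedPosSemidef (hA : IsPeriodicElliptic A) :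
    IsBoundedPosSemidef A where
  memLp j k := by
    obtain ⟨M, hM⟩ := hA.bounded
    exact memLp_top_of_bound (hA.measurable j k).aestronglyMeasurable M (ae_restrict_of_ae (hM j k))
  posSemidef := by
    obtain ⟨α, hα, hell⟩ := hA.elliptic
    filter_upwards [ae_restrict_of_ae hA.symm, ae_restrict_of_ae hell] with y hsymm hy
    refine .of_dotProduct_mulVec_nonneg hsymm fun ξ => ?_
    calc 0 ≤ α * ∑ j, ξ j ^ 2 := by positivity
      _ ≤ ∑ j, (∑ k, A y j k * ξ k) * ξ j := hy ξ
      _ = star ξ ⬝ᵥ A y *ᵥ ξ := by simp [dotProduct, Matrix.mulVec, mul_comm]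

variable (hA : IsBoundedPosSemidef A)

/-- The operators of the Bloch problem with coefficients `A`, acting from `H²_♯(Y)` to `L²_♯(Y)`. -/
def blochData : FormData d (HY d 2) (L2Y d) where
  incl := HY.embed d 2
  grad := HY.pderiv
  lap := HY.laplacian d
  coef j k := linftyMul (hA.memLp j k).ofReal

include hA

theorem gradOp_blochData (η : Fin d → ℝ) (j : Fin d) (u : HY d 2) :
    (blochData hA).gradOp η j u = shiftGrad η j (HY.toL2 u) := by
  rw [HY.shiftGrad_toL2, ← HY.embed_apply]
  rfl

theorem lapOp_blochData (η : Fin d → ℝ) (u : HY d 2) :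
    (blochData hA).lapOp η u = shiftLaplacian η (HY.toL2 u) := by
  rw [HY.shiftLaplacian_toL2, ← HY.embed_apply]
  simp [FormData.lapOp, blochData]

theorem coeFn_coef_blochData (j k : Fin d) (u : L2Y d) :
    (blochData hA).coef j k u =ᵐ[muY d] fun y => (A y j k : ℂ) * u y :=
  coeFn_linftyMul _ u

theorem inner_coef_blochData (x y : L2Y d) (j k : Fin d) :
    ⟪x, (blochData hA).coef j k y⟫_ℂ = ∫ t in cellY d, (A t j k : ℂ) * y t * conj (x t) := by
  rw [L2.inner_def]
  refine integral_congr_ae ?_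
  filter_upwards [coeFn_coef_blochData hA j k y] with t ht
  rw [ht, RCLike.inner_apply]

theorem integrable_coef_mul (x y : L2Y d) (j k : Fin d) :
    Integrable (fun t => (A t j k : ℂ) * y t * conj (x t)) (muY d) := by
  refine (L2.integrable_inner (𝕜 := ℂ) x ((blochData hA).coef j k y)).congr ?_
  filter_upwards [coeFn_coef_blochData hA j k y] with t ht
  rw [ht, RCLike.inner_apply]

theorem integrable_sum_coef_mul (ξ ζ : Fin d → L2Y d) :
    Integrable (fun y => ∑ j, (∑ k, (A y j k : ℂ) * ξ k y) * conj (ζ j y)) (muY d) := by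
  simp only [Finset.sum_mul]
  exact integrable_finsetSum _ fun j _ => integrable_finsetSum _ fun k _ =>
    integrable_coef_mul hA _ _ j k

theorem sum_inner_coef_blochData (ξ ζ : Fin d → L2Y d) :
    ∑ j, ⟪ζ j, ∑ k, (blochData hA).coef j k (ξ k)⟫_ℂ =
      ∫ y in cellY d, ∑ j, (∑ k, (A y j k : ℂ) * ξ k y) * conj (ζ j y) := by
  simp only [inner_sum, inner_coef_blochData, Finset.sum_mul]
  rw [integral_finsetSum _ fun j _ =>
    integrable_finsetSum _ fun k _ => integrable_coef_mul hA _ _ j k]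
  refine Finset.sum_congr rfl fun j _ => ?_
  rw [integral_finsetSum _ fun k _ => integrable_coef_mul hA _ _ j k]

theorem form_blochData (ρ : ℝ) (η : Fin d → ℝ) (u v : HY d 2) :
    (blochData hA).form ρ η u v = blochForm A ρ η (HY.toL2 u) (HY.toL2 v) := by
  simp only [FormData.form, sum_inner_coef_blochData, blochForm, gradOp_blochData, lapOp_blochData]
  rw [L2.inner_def]
  rfl

theorem coefSymm_blochData : (blochData hA).CoefSymm := by
  intro j k x y
  rw [← inner_conj_symm _ y, inner_coef_blochData, inner_coef_blochData, ← integral_conj]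
  refine integral_congr_ae ?_
  filter_upwards [hA.posSemidef] with t ht
  have hsymm : A t j k = A t k j := ht.1.apply k j
  simp only [map_mul, Complex.conj_ofReal, Complex.conj_conj, hsymm]
  ring

omit hA in
theorem re_sum_mul_conj_nonneg {M : Matrix (Fin d) (Fin d) ℝ} (hM : M.PosSemidef)
    (z : Fin d → ℂ) : 0 ≤ (∑ j, (∑ k, (M j k : ℂ) * z k) * conj (z j)).re := by
  have hsplit : (∑ j, (∑ k, (M j k : ℂ) * z k) * conj (z j)).re =
      star (fun j => (z j).re) ⬝ᵥ M *ᵥ (fun j => (z j).re) +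
        star (fun j => (z j).im) ⬝ᵥ M *ᵥ (fun j => (z j).im) := by
    simp only [Complex.re_sum, dotProduct, Matrix.mulVec, ← Finset.sum_add_distrib]
    refine Finset.sum_congr rfl fun j _ => ?_
    simp [Complex.mul_re, mul_comm]
  rw [hsplit]
  exact add_nonneg (hM.dotProduct_mulVec_nonneg _) (hM.dotProduct_mulVec_nonneg _)

theorem coefNonneg_blochData : (blochData hA).CoefNonneg := by
  intro ξ
  rw [sum_inner_coef_blochData]
  change 0 ≤ Complex.reCLM _
  rw [← Complex.reCLM.integral_comp_comm (integrable_sum_coef_mul hA ξ ξ)]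
  refine integral_nonneg_of_ae ?_
  filter_upwards [hA.posSemidef] with y hy
  exact re_sum_mul_conj_nonneg hy fun j => ξ j y

theorem mem_meanZero_blochData {u : HY d 2} :
    u ∈ (blochData hA).meanZero (HY.one d) ↔ fourierY (HY.toL2 u) 0 = 0 := by
  rw [FormData.mem_meanZero]
  change ⟪HY.embed d 2 (HY.one d), HY.embed d 2 u⟫_ℂ = 0 ↔ _
  rw [HY.embed_one, inner_expL2, HY.embed_apply,
    mul_eq_zero_iff_left (Complex.ofReal_ne_zero.2 (cellVolume_pos d).ne')]

theorem isAdmissible_blochData : (blochData hA).IsAdmissible (HY.one d) where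
  nonneg := coefNonneg_blochData hA
  symm := coefSymm_blochData hA
  grad_const := HY.pderiv_one
  lap_const := HY.laplacian_one
  const_ne := HY.one_ne_zero
  injective u v huv := HY.toL2_injective (by simpa [blochData, HY.embed_apply] using huv)
  inner_grad j u := by
    change ⟪HY.embed d 2 (HY.one d), HY.pderiv j u⟫_ℂ = 0
    rw [HY.embed_one, HY.inner_expL2_zero_pderiv]
  inner_lap u := by
    change ⟪HY.embed d 2 (HY.one d), HY.laplacian d u⟫_ℂ = 0
    rw [HY.embed_one, HY.inner_expL2_zero_laplacian]
  exists_le_norm_lap := ⟨√(cellVolume d) / 2, half_pos (Real.sqrt_pos.2 (cellVolume_pos d)),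
    fun _ hx => HY.norm_le_norm_laplacian ((mem_meanZero_blochData hA).1 hx)⟩

end Coefficients

section Conjugation

variable {d : ℕ}

theorem fourierY_star (u : L2Y d) (n : Fin d → ℤ) :
    fourierY (star u) n = conj (fourierY u (-n)) := by
  have hconj : ∫ y in cellY d, (star u : L2Y d) y * conj (expY n y) =
      conj (∫ y in cellY d, u y * conj (expY (-n) y)) := by
    rw [← integral_conj]
    refine integral_congr_ae ?_
    filter_upwards [Lp.coeFn_star u] with y hy
    rw [hy, map_mul, Complex.conj_conj, conj_expY, Pi.star_apply, RCLike.star_def]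
  rw [fourierY, fourierY, meanY, meanY, hconj, Complex.real_smul, Complex.real_smul, map_mul,
    Complex.conj_ofReal]

theorem star_zero_L2Y : star (0 : L2Y d) = 0 :=
  fourierY_ext fun n => by rw [fourierY_star, fourierY_zero, fourierY_zero, map_zero]

theorem fourierY_star_eq_mul {j : Fin d} {u g : L2Y d}
    (h : ∀ n, fourierY g n = Complex.I * n j * fourierY u n) (n : Fin d → ℤ) :
    fourierY (star g) n = Complex.I * n j * fourierY (star u) n := by
  simp [fourierY_star, h]

theorem pderivY_star (j : Fin d) (u : L2Y d) : pderivY j (star u) = star (pderivY j u) := by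
  by_cases hu : ∃ g : L2Y d, ∀ n, fourierY g n = Complex.I * n j * fourierY u n
  · obtain ⟨g, hg⟩ := hu
    rw [pderivY_eq hg, pderivY_eq (fourierY_star_eq_mul hg)]
  · have hustar : ¬∃ g : L2Y d, ∀ n, fourierY g n = Complex.I * n j * fourierY (star u) n :=
      fun ⟨g, hg⟩ => hu ⟨star g, by simpa only [star_star] using fourierY_star_eq_mul hg⟩
    rw [pderivY, dif_neg hustar, pderivY, dif_neg hu, star_zero_L2Y]

theorem shiftGrad_star (η : Fin d → ℝ) (j : Fin d) (u : L2Y d) :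
    shiftGrad (-η) j (star u) = star (shiftGrad η j u) :=
  fourierY_ext fun n => by
    simp only [shiftGrad, pderivY_star, fourierY_star, fourierY_add, fourierY_smul, map_add,
      map_mul, Complex.conj_I, Complex.conj_ofReal, Pi.neg_apply, Complex.ofReal_neg, mul_neg,
      neg_mul]

theorem shiftLaplacian_star (η : Fin d → ℝ) (u : L2Y d) :
    shiftLaplacian (-η) (star u) = star (shiftLaplacian η u) :=
  fourierY_ext fun n => by
    simp only [shiftLaplacian, shiftGrad_star, fourierY_sum, fourierY_star, map_sum]

theorem integral_star_mul_conj_star (u v : L2Y d) :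
    ∫ y in cellY d, (star u : L2Y d) y * conj ((star v : L2Y d) y) =
      conj (∫ y in cellY d, u y * conj (v y)) := by
  rw [← integral_conj]
  refine integral_congr_ae ?_
  filter_upwards [Lp.coeFn_star u, Lp.coeFn_star v] with y hu hv
  rw [hu, hv, map_mul]
  rfl

theorem blochForm_star (A : (Fin d → ℝ) → Matrix (Fin d) (Fin d) ℝ) (ρ : ℝ) (η : Fin d → ℝ)
    (u v : L2Y d) : blochForm A ρ (-η) (star u) (star v) = conj (blochForm A ρ η u v) := by
  simp only [blochForm, shiftGrad_star, shiftLaplacian_star, integral_star_mul_conj_star, map_add,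
    map_mul, map_pow, Complex.conj_ofReal, ← integral_conj (f := fun _ => ∑ _, _)]
  congr 1
  refine integral_congr_ae ?_
  have hu : ∀ᵐ y ∂muY d, ∀ j, (star (shiftGrad η j u) : L2Y d) y = conj (shiftGrad η j u y) :=
    ae_all_iff.2 fun j => Lp.coeFn_star _
  have hv : ∀ᵐ y ∂muY d, ∀ j, (star (shiftGrad η j v) : L2Y d) y = conj (shiftGrad η j v y) :=
    ae_all_iff.2 fun j => Lp.coeFn_star _
  filter_upwards [hu, hv] with y hu_y hv_y
  simp only [hu_y, hv_y, map_sum, map_mul, Complex.conj_ofReal]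

/-- Complex conjugation on `H^s_♯(Y)`. -/
def HY.conjugate {s : ℕ} (u : HY d s) : HY d s :=
  ⟨star (HY.toL2 u), by
    have h := (Equiv.neg (Fin d → ℤ)).summable_iff.2 u.hasSum_norm_sq.summable
    refine h.congr fun n => ?_
    simp [fourierY_star, sobolevWeight]⟩

theorem HY.toL2_conjugate {s : ℕ} (u : HY d s) : HY.toL2 u.conjugate = star (HY.toL2 u) := rfl

theorem HY.conjugate_involutive {s : ℕ} :
    Function.Involutive (HY.conjugate : HY d s → HY d s) := fun u =>
  HY.toL2_injective (by rw [HY.toL2_conjugate, HY.toL2_conjugate, star_star])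

theorem HY.conjugate_zero {s : ℕ} : (0 : HY d s).conjugate = 0 :=
  HY.toL2_injective (by rw [HY.toL2_conjugate, map_zero, star_zero_L2Y])

variable {A : (Fin d → ℝ) → Matrix (Fin d) (Fin d) ℝ} {ρ : ℝ}

theorem IsBlochEigenfunction.conjugate {η : Fin d → ℝ} {lam : ℝ} {φ : HY d 2}
    (h : IsBlochEigenfunction A ρ η lam φ) : IsBlochEigenfunction A ρ (-η) lam φ.conjugate := by
  refine ⟨fun h0 => h.1 (HY.conjugate_involutive.injective (h0.trans HY.conjugate_zero.symm)),
    HY.conjugate_involutive.surjective.forall.2 fun v => ?_⟩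
  rw [HY.toL2_conjugate, HY.toL2_conjugate, blochForm_star, h.2, map_mul, Complex.conj_ofReal,
    integral_star_mul_conj_star]

theorem blochEigenvalues_neg_subset (η : Fin d → ℝ) :
    blochEigenvalues A ρ η ⊆ blochEigenvalues A ρ (-η) :=
  fun _ ⟨φ, hφ⟩ => ⟨φ.conjugate, hφ.conjugate⟩

theorem firstEigenvalue_neg (η : Fin d → ℝ) : firstEigenvalue A ρ (-η) = firstEigenvalue A ρ η :=
  congrArg sInf <| Set.Subset.antisymm
    (by simpa only [neg_neg] using blochEigenvalues_neg_subset (A := A) (ρ := ρ) (-η))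
    (blochEigenvalues_neg_subset η)

theorem eigenvalueDeriv_eq_zero_of_analyticAt_of_odd (h : AnalyticAt ℝ (firstEigenvalue A ρ) 0)
    {β : Fin d → ℕ} (hβ : Odd (∑ j, β j)) : eigenvalueDeriv A ρ β = 0 :=
  multiPartial_eq_zero_of_dilation h (t := -1) (s := 1)
    (Eventually.of_forall fun η => by rw [neg_one_smul, one_smul, firstEigenvalue_neg])
    (by norm_num [hβ.neg_one_pow])

end Conjugation

/-- The normalizing constant `(2π)^{-d/2}`. -/
def normConst (d : ℕ) : ℝ := (2 * Real.pi) ^ (-(d : ℝ) / 2)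

theorem normConst_pos (d : ℕ) : 0 < normConst d := by unfold normConst; positivity

section Symbols

variable {d : ℕ}

/-- The symbol `|η|⁴` of the biharmonic operator. -/
def quarticSymbol (η : Fin d → ℝ) : ℝ := (∑ j, η j ^ 2) ^ 2

/-- The quadratic form `M_Y(A) η · η` of the averaged coefficients. -/
def meanQuadratic (A : (Fin d → ℝ) → Matrix (Fin d) (Fin d) ℝ) (η : Fin d → ℝ) : ℝ :=
  ∑ j, ∑ k, (η j * η k) * meanY fun y => A y j k

theorem analyticAt_quarticSymbol (η : Fin d → ℝ) : AnalyticAt ℝ quarticSymbol η := by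
  have h : ContDiff ℝ ω (quarticSymbol (d := d)) := by unfold quarticSymbol; fun_prop
  exact h.contDiffAt.analyticAt

theorem multiPartial_quarticSymbol {β : Fin d → ℕ} (hβ : ∑ j, β j ≠ 4) :
    multiPartial β quarticSymbol 0 = 0 := by
  refine multiPartial_eq_zero_of_dilation (analyticAt_quarticSymbol 0) (t := 2) (s := 2 ^ 4)
    (Eventually.of_forall fun η => ?_)
    fun h => hβ (pow_right_injective₀ two_pos (OfNat.ofNat_ne_one 2) h)
  simp only [quarticSymbol, Pi.smul_apply, smul_eq_mul, mul_pow, ← Finset.mul_sum]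
  ring

variable (A : (Fin d → ℝ) → Matrix (Fin d) (Fin d) ℝ)

theorem analyticAt_meanQuadratic (η : Fin d → ℝ) : AnalyticAt ℝ (meanQuadratic A) η := by
  have h : ContDiff ℝ ω (meanQuadratic A) := by unfold meanQuadratic; fun_prop
  exact h.contDiffAt.analyticAt

theorem multiPartial_meanQuadratic {β : Fin d → ℕ} (hβ : ∑ j, β j ≠ 2) :
    multiPartial β (meanQuadratic A) 0 = 0 := by
  refine multiPartial_eq_zero_of_dilation (analyticAt_meanQuadratic A 0) (t := 2) (s := 2 ^ 2)
    (Eventually.of_forall fun η => ?_)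
    fun h => hβ (pow_right_injective₀ two_pos (OfNat.ofNat_ne_one 2) h)
  simp only [meanQuadratic, Pi.smul_apply, smul_eq_mul, Finset.mul_sum]
  exact Finset.sum_congr rfl fun j _ => Finset.sum_congr rfl fun k _ => by ring

variable {A}

theorem IsBoundedPosSemidef.meanY_symm (hA : IsBoundedPosSemidef A) (j k : Fin d) :
    meanY (fun y => A y j k) = meanY fun y => A y k j := by
  refine congrArg (((2 * Real.pi) ^ d)⁻¹ • ·) (integral_congr_ae ?_)
  filter_upwards [hA.posSemidef] with y hy
  exact hy.1.apply k j

theorem multiPartial_meanQuadratic_pair (hA : IsBoundedPosSemidef A) (j k : Fin d) :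
    multiPartial (unitIndex j + unitIndex k) (meanQuadratic A) 0 =
      2 * meanY fun y => A y j k := by
  have h := multiPartial_pair_quadratic (fun a b => meanY fun y => A y a b) j k 0
  rwa [hA.meanY_symm k j, ← two_mul] at h

theorem sum_unitIndex (j : Fin d) : ∑ i, unitIndex j i = 1 := by simp [unitIndex]

end Symbols

section BlochData

variable {d : ℕ} {A : (Fin d → ℝ) → Matrix (Fin d) (Fin d) ℝ} (hA : IsBoundedPosSemidef A)

include hA

theorem isBlochEigenfunction_iff {ρ : ℝ} {η : Fin d → ℝ} {lam : ℝ} {φ : HY d 2} :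
    IsBlochEigenfunction A ρ η lam φ ↔ (blochData hA).IsEigenvector ρ η lam φ := by
  have hinner (v : HY d 2) : ⟪(blochData hA).incl v, (blochData hA).incl φ⟫_ℂ =
      ∫ y in cellY d, HY.toL2 φ y * conj (HY.toL2 v y) := by
    change ⟪HY.embed d 2 v, HY.embed d 2 φ⟫_ℂ = _
    rw [HY.embed_apply, HY.embed_apply, L2.inner_def]
    rfl
  simp only [IsBlochEigenfunction, FormData.IsEigenvector, form_blochData, hinner]

theorem incl_blochData_one : (blochData hA).incl (HY.one d) = expL2 0 := HY.embed_one

omit hA in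
theorem norm_expL2_zero_sq : ‖(expL2 0 : L2Y d)‖ ^ 2 = cellVolume d := by
  rw [← @inner_self_eq_norm_sq ℂ, inner_expL2_expL2, if_pos rfl]
  exact Complex.ofReal_re _

theorem inner_coef_expL2_zero (j k : Fin d) :
    ⟪expL2 0, (blochData hA).coef j k (expL2 0)⟫_ℂ =
      ((cellVolume d * meanY fun y => A y j k : ℝ) : ℂ) := by
  rw [inner_coef_blochData, meanY, smul_eq_mul, ← cellVolume,
    mul_inv_cancel_left₀ (cellVolume_pos d).ne', ← integral_complex_ofReal]
  refine integral_congr_ae ?_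
  filter_upwards [coeFn_expL2 (0 : Fin d → ℤ)] with y hy
  simp [hy, expY_zero]

omit hA in
/-- The second order coefficient of the scaled eigenvalue as a power series in `ε = ρ⁻²`: the cell
average of the flux created by the corrector `χ`. -/
def meanCorrectorFlux (hA : IsBoundedPosSemidef A) (S : Submodule ℂ (HY d 2)) (η : Fin d → ℝ)
    (χ : S) : ℝ :=
  (cellVolume d)⁻¹ * (((blochData hA).restrict S).correctorFlux (expL2 0) η χ).re

theorem analyticAt_meanCorrectorFlux (S : Submodule ℂ (HY d 2)) {E : Type*} [NormedAddCommGroup E]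
    [NormedSpace ℝ E] {f : E → Fin d → ℝ} {χ : E → S} {p : E} (hf : AnalyticAt ℝ f p)
    (hχ : AnalyticAt ℝ χ p) : AnalyticAt ℝ (fun q => meanCorrectorFlux hA S (f q) (χ q)) p := by
  exact analyticAt_const.mul ((Complex.reCLM.analyticAt _).comp
    (((blochData hA).restrict S).analyticAt_correctorFlux (expL2 0) hf hχ))

theorem re_scaledEigenvalue_blochData (S : Submodule ℂ (HY d 2)) (η : Fin d → ℝ) (ε : ℝ) (χ : S) :
    (((blochData hA).restrict S).scaledEigenvalue (expL2 0) η ε χ).re =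
      quarticSymbol η + ε * meanQuadratic A η + ε ^ 2 * meanCorrectorFlux hA S η χ := by
  have hmean : ∑ j, ∑ k, (η j : ℂ) * η k *
      ⟪expL2 0, ((blochData hA).restrict S).coef j k (expL2 0)⟫_ℂ =
      ((cellVolume d * meanQuadratic A η : ℝ) : ℂ) := by
    change ∑ j, ∑ k, (η j : ℂ) * η k * ⟪expL2 0, (blochData hA).coef j k (expL2 0)⟫_ℂ = _
    simp only [inner_coef_expL2_zero, meanQuadratic, Finset.mul_sum]
    push_cast
    exact Finset.sum_congr rfl fun j _ => Finset.sum_congr rfl fun k _ => by ring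
  have hquartic : (∑ j, (η j : ℂ) ^ 2) ^ 2 = ((quarticSymbol η : ℝ) : ℂ) := by
    simp [quarticSymbol]
  have hvol := (cellVolume_pos d).ne'
  rw [FormData.scaledEigenvalue, FormData.sum_inner_flux, hmean, hquartic, norm_expL2_zero_sq,
    Complex.add_re, Complex.re_ofReal_mul, Complex.ofReal_re, Complex.add_re, Complex.ofReal_re,
    Complex.re_ofReal_mul, meanCorrectorFlux]
  field_simp
  ring

theorem meanY_smul_one_add (a : ℂ) {x : HY d 2} (hx : x ∈ (blochData hA).meanZero (HY.one d)) :
    meanY (HY.toL2 (a • (HY.one d + x)) : (Fin d → ℝ) → ℂ) = a := by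
  have hmean (u : L2Y d) : meanY (u : (Fin d → ℝ) → ℂ) = fourierY u 0 := by
    simp [fourierY, expY_zero]
  rw [hmean, map_smul, map_add, fourierY_smul, fourierY_add, (mem_meanZero_blochData hA).1 hx,
    HY.toL2_one, fourierY_expL2, if_pos rfl, add_zero, mul_one]

end BlochData

section Expansion

variable {d : ℕ} {A : (Fin d → ℝ) → Matrix (Fin d) (Fin d) ℝ} {ρ : ℝ}

/-- Near `η = 0` the first Bloch eigenpair at `ρ` is well defined, and is given by analytic
functions: the corrector `χ`, measured in units of `ρ⁻²`, and the remainder `r` that is left of the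
eigenvalue, in the same units, after its leading terms are subtracted. -/
structure IsEigenpairExpansion (A : (Fin d → ℝ) → Matrix (Fin d) (Fin d) ℝ) (ρ : ℝ)
    (χ : (Fin d → ℝ) → HY d 2) (r : (Fin d → ℝ) → ℝ) : Prop where
  analyticAt_corrector : AnalyticAt ℝ χ 0
  analyticAt_remainder : AnalyticAt ℝ r 0
  isLeast : ∀ᶠ η in 𝓝 0, IsLeast (blochEigenvalues A ρ η)
    (ρ ^ 2 * quarticSymbol η + meanQuadratic A η + (ρ ^ 2)⁻¹ * r η)
  isNormalizedGroundState_iff : ∀ᶠ η in 𝓝 0, ∀ φ, IsNormalizedGroundState A ρ η φ ↔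
    φ = normConst d • (HY.one d + (ρ ^ 2)⁻¹ • χ η)

section Existence

variable (hA : IsBoundedPosSemidef A)

include hA

theorem isLeast_and_isNormalizedGroundState_iff {κ lam : ℝ} {η : Fin d → ℝ}
    (hcoercive : ∀ x ∈ (blochData hA).meanZero (HY.one d),
      κ * ‖(blochData hA).incl x‖ ^ 2 ≤ ((blochData hA).form ρ η x x).re)
    {x : HY d 2} (hx : x ∈ (blochData hA).meanZero (HY.one d)) (hlam : lam < κ)
    (h : (blochData hA).IsEigenvector ρ η lam (HY.one d + x)) :
    IsLeast (blochEigenvalues A ρ η) lam ∧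
      ∀ φ, IsNormalizedGroundState A ρ η φ ↔ φ = normConst d • (HY.one d + x) := by
  have hF := isAdmissible_blochData hA
  have hleast : IsLeast (blochEigenvalues A ρ η) lam := by
    simpa only [blochEigenvalues, isBlochEigenfunction_iff hA] using
      hF.isLeast_eigenvalue hcoercive hlam (x := ⟨x, hx⟩) h
  refine ⟨hleast, fun φ => ?_⟩
  rw [IsNormalizedGroundState, firstEigenvalue, hleast.csInf_eq, isBlochEigenfunction_iff hA,
    ← Complex.coe_smul, ← normConst]
  constructor
  · rintro ⟨hφ, hmean⟩
    obtain ⟨-, a, rfl⟩ := hF.exists_eq_smul hcoercive hlam hlam (x := ⟨x, hx⟩) h hφ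
    rw [← hmean, meanY_smul_one_add hA _ hx]
  · rintro rfl
    exact ⟨h.smul (Complex.ofReal_ne_zero.2 (normConst_pos d).ne'), meanY_smul_one_add hA _ hx⟩

theorem isEigenvector_of_residual_eq_zero (hρ : ρ ≠ 0) {η : Fin d → ℝ}
    {χ : (blochData hA).meanZero (HY.one d)}
    (hres : ((blochData hA).restrict _).residual (expL2 0) η (ρ ^ 2)⁻¹ χ = 0) :
    (blochData hA).IsEigenvector ρ η
      (ρ ^ 2 * quarticSymbol η + meanQuadratic A η + (ρ ^ 2)⁻¹ * meanCorrectorFlux hA _ η χ)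
      (HY.one d + (ρ ^ 2)⁻¹ • (χ : HY d 2)) := by
  have hρε : ρ ^ 2 * (ρ ^ 2)⁻¹ = 1 := mul_inv_cancel₀ (pow_ne_zero 2 hρ)
  have heig := (isAdmissible_blochData hA).isEigenvector_of_residual_eq_zero hρε (η := η) (χ := χ)
    (by rwa [incl_blochData_one])
  rw [incl_blochData_one, re_scaledEigenvalue_blochData, Complex.coe_smul] at heig
  convert heig using 1
  linear_combination
    -(meanQuadratic A η + (ρ ^ 2)⁻¹ * meanCorrectorFlux hA _ η χ) * hρε

theorem isEigenpairExpansion_of_residual_eq_zero (hρ : 1 ≤ ρ)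
    {χ : (Fin d → ℝ) → (blochData hA).meanZero (HY.one d)} (hχ : AnalyticAt ℝ χ 0)
    (hres : ∀ᶠ η in 𝓝 0,
      ((blochData hA).restrict _).residual (expL2 0) η (ρ ^ 2)⁻¹ (χ η) = 0) :
    IsEigenpairExpansion A ρ (fun η => χ η) fun η => meanCorrectorFlux hA _ η (χ η) := by
  have hflux := analyticAt_meanCorrectorFlux hA _ analyticAt_id hχ
  let lam (η : Fin d → ℝ) : ℝ := ρ ^ 2 * quarticSymbol η + meanQuadratic A η +
    (ρ ^ 2)⁻¹ * meanCorrectorFlux hA _ η (χ η)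
  have hlam_tendsto : Tendsto lam (𝓝 0) (𝓝 0) := by
    have hlam_zero : lam 0 = 0 := by
      simp [lam, quarticSymbol, meanQuadratic, meanCorrectorFlux, FormData.correctorFlux]
    have hcont : ContinuousAt lam 0 :=
      ((analyticAt_const.mul (analyticAt_quarticSymbol 0)).add (analyticAt_meanQuadratic A 0)).add
        (analyticAt_const.mul hflux) |>.continuousAt
    rwa [ContinuousAt, hlam_zero] at hcont
  obtain ⟨κ, hκ, hcoercive⟩ := (isAdmissible_blochData hA).exists_coercive
  have hgroundState : ∀ᶠ η in 𝓝 0, IsLeast (blochEigenvalues A ρ η) (lam η) ∧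
      ∀ φ, IsNormalizedGroundState A ρ η φ ↔
        φ = normConst d • (HY.one d + (ρ ^ 2)⁻¹ • (χ η : HY d 2)) := by
    filter_upwards [hres, hcoercive, hlam_tendsto.eventually_lt_const hκ] with η hη hcoer hlt
    exact isLeast_and_isNormalizedGroundState_iff hA (hcoer ρ hρ)
      (Submodule.smul_of_tower_mem _ _ (χ η).2) hlt
      (isEigenvector_of_residual_eq_zero hA (zero_lt_one.trans_le hρ).ne' hη)
  exact ⟨(((blochData hA).meanZero (HY.one d)).subtypeL.restrictScalars ℝ).analyticAt _ |>.comp hχ,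
    hflux, hgroundState.mono fun _ h => h.1, hgroundState.mono fun _ h => h.2⟩

theorem exists_analyticAt_isEigenpairExpansion {ε₀ : ℝ} (hε₀ : 0 ≤ ε₀) :
    ∃ (χ : (Fin d → ℝ) × ℝ → HY d 2) (r : (Fin d → ℝ) × ℝ → ℝ),
      AnalyticAt ℝ χ (0, ε₀) ∧ AnalyticAt ℝ r (0, ε₀) ∧
      ∀ᶠ ε in 𝓝 ε₀, ∀ ρ : ℝ, 1 ≤ ρ → (ρ ^ 2)⁻¹ = ε →
        IsEigenpairExpansion A ρ (fun η => χ (η, ε)) fun η => r (η, ε) := by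
  have hF := isAdmissible_blochData hA
  obtain ⟨c, hc, hlap⟩ := hF.exists_le_norm_lap
  obtain ⟨χ, hχ, hres⟩ := FormData.exists_analyticAt_residual_eq_zero
    (F := (blochData hA).restrict ((blochData hA).meanZero (HY.one d)))
    hF.nonneg hc (fun x => hlap x x.2) (expL2 0) hε₀
  refine ⟨fun p => χ p, fun p => meanCorrectorFlux hA _ p.1 (χ p),
    (((blochData hA).meanZero (HY.one d)).subtypeL.restrictScalars ℝ).analyticAt _ |>.comp hχ,
    analyticAt_meanCorrectorFlux hA _ analyticAt_fst hχ, ?_⟩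
  have hline : Tendsto (fun ε : ℝ => ((0 : Fin d → ℝ), ε)) (𝓝 ε₀) (𝓝 (0, ε₀)) :=
    Continuous.tendsto (by fun_prop) _
  filter_upwards [hline.eventually hχ.eventually_analyticAt,
    hline.eventually hres.eventually_nhds] with ε hχε hresε ρ hρ hρε
  have hslice : Tendsto (fun η : Fin d → ℝ => (η, ε)) (𝓝 0) (𝓝 (0, ε)) :=
    Continuous.tendsto (by fun_prop) _
  refine isEigenpairExpansion_of_residual_eq_zero hA hρ
    (hχε.comp_of_eq (analyticAt_id.prod analyticAt_const) rfl) ?_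
  rw [hρε]
  exact hslice.eventually hresε

/-- The bound is uniform in `ρ` because `ε = ρ⁻²` stays in the compact interval `[0, 1]`, whose
end point `ε = 0` is included in `exists_analyticAt_isEigenpairExpansion`. -/
theorem exists_isEigenpairExpansion_norm_le (β : Fin d → ℕ) :
    ∃ C, ∀ ρ : ℝ, 1 ≤ ρ → ∃ χ r, IsEigenpairExpansion A ρ χ r ∧
      ‖multiPartial β χ 0‖ ≤ C ∧ |multiPartial β r 0| ≤ C := by
  refine exists_forall_le_of_locally (fun ρ a b hab ⟨χ, r, h, hχ, hr⟩ =>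
    ⟨χ, r, h, hχ.trans hab, hr.trans hab⟩) fun ε₀ hε₀ => ?_
  obtain ⟨χ, r, hχ, hr, hexp⟩ := exists_analyticAt_isEigenpairExpansion hA hε₀.1
  obtain ⟨C, hC⟩ := exists_norm_multiPartial_slice_le hχ β
  obtain ⟨C', hC'⟩ := exists_norm_multiPartial_slice_le hr β
  refine ⟨max C C', ?_⟩
  filter_upwards [hexp, hC, hC'] with ε hε hχε hrε ρ hρ hρε
  exact ⟨_, _, hε ρ hρ hρε, hχε.trans (le_max_left _ _), hrε.trans (le_max_right _ _)⟩

end Existence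

theorem IsNormalizedGroundState.of_exists {η : Fin d → ℝ}
    (h : ∃ φ, IsNormalizedGroundState A ρ η φ) :
    IsNormalizedGroundState A ρ η (firstEigenfunction A ρ η) := by
  rw [firstEigenfunction, dif_pos h]
  exact h.choose_spec

theorem sobolevNorm_one_le (u : HY d 2) : sobolevNorm 1 (HY.toL2 u) ≤ ‖u‖ := by
  have hsum := HY.hasSum_norm_sq u
  have hle (n : Fin d → ℤ) : sobolevWeight 1 n * ‖fourierY (HY.toL2 u) n‖ ^ 2 ≤
      sobolevWeight 2 n * ‖fourierY (HY.toL2 u) n‖ ^ 2 := by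
    gcongr
    exact pow_le_pow_right₀ (by simpa [sobolevWeight] using one_le_sobolevWeight 1 n) one_le_two
  have hnonneg (n : Fin d → ℤ) : 0 ≤ sobolevWeight 1 n * ‖fourierY (HY.toL2 u) n‖ ^ 2 :=
    mul_nonneg (sobolevWeight_pos 1 n).le (sq_nonneg _)
  refine Real.sqrt_le_iff.2 ⟨norm_nonneg u, hsum.tsum_eq ▸ ?_⟩
  exact (hsum.summable.of_nonneg_of_le hnonneg hle).tsum_le_tsum hle hsum.summable

namespace IsEigenpairExpansion

variable {χ : (Fin d → ℝ) → HY d 2} {r : (Fin d → ℝ) → ℝ} (h : IsEigenpairExpansion A ρ χ r)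

include h

theorem firstEigenvalue_eventuallyEq :
    (fun η => ρ ^ 2 * quarticSymbol η + meanQuadratic A η + (ρ ^ 2)⁻¹ * r η) =ᶠ[𝓝 0]
      firstEigenvalue A ρ :=
  h.isLeast.mono fun _ hη => hη.csInf_eq.symm

theorem firstEigenfunction_eventuallyEq :
    (fun η => normConst d • HY.one d + (normConst d * (ρ ^ 2)⁻¹) • χ η) =ᶠ[𝓝 0]
      firstEigenfunction A ρ := by
  filter_upwards [h.isNormalizedGroundState_iff] with η hη
  rw [(hη _).1 (.of_exists ⟨_, (hη _).2 rfl⟩), smul_add, smul_smul]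

theorem eventually_isLeast_and_existsUnique : ∀ᶠ η in 𝓝 0,
    IsLeast (blochEigenvalues A ρ η) (firstEigenvalue A ρ η) ∧
      (∃! φ, IsNormalizedGroundState A ρ η φ) ∧
      IsNormalizedGroundState A ρ η (firstEigenfunction A ρ η) := by
  filter_upwards [h.isLeast, h.isNormalizedGroundState_iff] with η hleast hiff
  refine ⟨?_, ⟨_, (hiff _).2 rfl, fun φ hφ => (hiff φ).1 hφ⟩, .of_exists ⟨_, (hiff _).2 rfl⟩⟩
  rwa [firstEigenvalue, hleast.csInf_eq]

theorem analyticAt_firstEigenvalue : AnalyticAt ℝ (firstEigenvalue A ρ) 0 :=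
  AnalyticAt.congr (((analyticAt_const.mul (analyticAt_quarticSymbol 0)).add
    (analyticAt_meanQuadratic A 0)).add (analyticAt_const.mul h.analyticAt_remainder))
    h.firstEigenvalue_eventuallyEq

theorem analyticAt_firstEigenfunction : AnalyticAt ℝ (firstEigenfunction A ρ) 0 :=
  AnalyticAt.congr (analyticAt_const.add (h.analyticAt_corrector.const_smul))
    h.firstEigenfunction_eventuallyEq

theorem eigenfunctionDerivNorm_le {β : Fin d → ℕ} (hβ : ∑ j, β j ≠ 0) :
    eigenfunctionDerivNorm A ρ β ≤ normConst d * ‖multiPartial β χ 0‖ / ρ ^ 2 := by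
  have hderiv : multiPartial β (firstEigenfunction A ρ) 0 =
      (normConst d * (ρ ^ 2)⁻¹) • multiPartial β χ 0 := by
    have hscaled := h.analyticAt_corrector.const_smul (c := normConst d * (ρ ^ 2)⁻¹)
    rw [← multiPartial_congr (analyticAt_const.add hscaled) h.firstEigenfunction_eventuallyEq]
    refine (multiPartial_const_add hscaled _ hβ).trans ?_
    exact multiPartial_clm_comp ((normConst d * (ρ ^ 2)⁻¹) • .id ℝ _) h.analyticAt_corrector β
  refine (sobolevNorm_one_le _).trans_eq ?_
  rw [hderiv, norm_smul, Real.norm_of_nonneg (by have := normConst_pos d; positivity)]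
  ring

theorem eigenvalueDeriv_eq (β : Fin d → ℕ) :
    eigenvalueDeriv A ρ β = ρ ^ 2 * multiPartial β quarticSymbol 0 +
      multiPartial β (meanQuadratic A) 0 + multiPartial β r 0 / ρ ^ 2 := by
  have hmul (c : ℝ) {f : (Fin d → ℝ) → ℝ} (hf : AnalyticAt ℝ f 0) :
      multiPartial β (fun η => c * f η) 0 = c * multiPartial β f 0 :=
    multiPartial_clm_comp (c • .id ℝ ℝ) hf β
  have hquartic : AnalyticAt ℝ (fun η : Fin d → ℝ => ρ ^ 2 * quarticSymbol η) 0 :=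
    analyticAt_const.mul (analyticAt_quarticSymbol 0)
  have hleading := hquartic.add (analyticAt_meanQuadratic A 0)
  have hr : AnalyticAt ℝ (fun η => (ρ ^ 2)⁻¹ * r η) 0 := analyticAt_const.mul h.analyticAt_remainder
  rw [eigenvalueDeriv, ← multiPartial_congr (hleading.add hr) h.firstEigenvalue_eventuallyEq]
  refine (multiPartial_add hleading hr β).trans ?_
  rw [multiPartial_add hquartic (analyticAt_meanQuadratic A 0), hmul _ (analyticAt_quarticSymbol 0),
    hmul _ h.analyticAt_remainder, inv_mul_eq_div]

end IsEigenpairExpansion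

section UniformBounds

variable (hA : IsBoundedPosSemidef A)

include hA

theorem exists_isEigenpairExpansion (hρ : 1 ≤ ρ) : ∃ χ r, IsEigenpairExpansion A ρ χ r := by
  obtain ⟨C, hC⟩ := exists_isEigenpairExpansion_norm_le hA 0
  obtain ⟨χ, r, h, -⟩ := hC ρ hρ
  exact ⟨χ, r, h⟩

theorem eigenvalueDeriv_eq_zero_of_odd (hρ : 1 ≤ ρ) {β : Fin d → ℕ} (hβ : Odd (∑ j, β j)) :
    eigenvalueDeriv A ρ β = 0 := by
  obtain ⟨χ, r, h⟩ := exists_isEigenpairExpansion hA hρ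
  exact eigenvalueDeriv_eq_zero_of_analyticAt_of_odd h.analyticAt_firstEigenvalue hβ

theorem exists_eigenfunctionDerivNorm_le_div_sq {β : Fin d → ℕ} (hβ : ∑ j, β j ≠ 0) :
    ∃ C, ∀ ρ : ℝ, 1 ≤ ρ → eigenfunctionDerivNorm A ρ β ≤ C / ρ ^ 2 := by
  obtain ⟨C, hC⟩ := exists_isEigenpairExpansion_norm_le hA β
  refine ⟨normConst d * C, fun ρ hρ => ?_⟩
  obtain ⟨χ, r, h, hχ, -⟩ := hC ρ hρ
  have hnorm := (normConst_pos d).le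
  exact (h.eigenfunctionDerivNorm_le hβ).trans (by gcongr)

theorem exists_abs_eigenvalueDeriv_sub_le_div_sq (β : Fin d → ℕ) :
    ∃ C, ∀ ρ : ℝ, 1 ≤ ρ → |eigenvalueDeriv A ρ β -
      (ρ ^ 2 * multiPartial β quarticSymbol 0 + multiPartial β (meanQuadratic A) 0)| ≤
        C / ρ ^ 2 := by
  obtain ⟨C, hC⟩ := exists_isEigenpairExpansion_norm_le hA β
  refine ⟨C, fun ρ hρ => ?_⟩
  obtain ⟨χ, r, h, -, hr⟩ := hC ρ hρ
  rw [h.eigenvalueDeriv_eq, add_sub_cancel_left, abs_div, abs_of_nonneg (sq_nonneg ρ)]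
  gcongr

omit hA in
theorem exists_le_of_le_div_sq {f : ℝ → ℝ} (h : ∃ C, ∀ ρ : ℝ, 1 ≤ ρ → f ρ ≤ C / ρ ^ 2) :
    ∃ C, ∀ ρ : ℝ, 1 ≤ ρ → f ρ ≤ C := by
  obtain ⟨C, hC⟩ := h
  refine ⟨|C|, fun ρ hρ => (hC ρ hρ).trans ?_⟩
  have hle : C / ρ ^ 2 ≤ |C| / ρ ^ 2 := by gcongr; exact le_abs_self C
  exact hle.trans (div_le_self (abs_nonneg C) (one_le_pow₀ hρ))

theorem exists_abs_half_eigenvalueDeriv_sub_le_div_sq (j k : Fin d) :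
    ∃ C, ∀ ρ : ℝ, 1 ≤ ρ → |1 / 2 * eigenvalueDeriv A ρ (unitIndex j + unitIndex k) -
      meanY fun y => A y j k| ≤ C / ρ ^ 2 := by
  obtain ⟨C, hC⟩ := exists_abs_eigenvalueDeriv_sub_le_div_sq hA (unitIndex j + unitIndex k)
  refine ⟨C / 2, fun ρ hρ => ?_⟩
  have hbound := hC ρ hρ
  rw [multiPartial_quarticSymbol (by simp [Finset.sum_add_distrib, sum_unitIndex]), mul_zero,
    zero_add, multiPartial_meanQuadratic_pair hA] at hbound
  have hhalf (x m : ℝ) : 1 / 2 * x - m = (x - 2 * m) / 2 := by ring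
  rw [hhalf, abs_div, abs_two, div_right_comm]
  gcongr

theorem exists_abs_eigenvalueDeriv_le_mul_sq (β : Fin d → ℕ) :
    ∃ C, ∀ ρ : ℝ, 1 ≤ ρ → |eigenvalueDeriv A ρ β| ≤ C * ρ ^ 2 := by
  obtain ⟨C, hC⟩ := exists_le_of_le_div_sq (exists_abs_eigenvalueDeriv_sub_le_div_sq hA β)
  set a := multiPartial β (quarticSymbol (d := d)) 0
  set b := multiPartial β (meanQuadratic A) 0
  refine ⟨|a| + (|b| + |C|), fun ρ hρ => ?_⟩
  have htriangle : |eigenvalueDeriv A ρ β| ≤ |ρ ^ 2 * a + b| + C :=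
    sub_le_iff_le_add'.1 ((abs_sub_abs_le_abs_sub _ _).trans (hC ρ hρ))
  calc |eigenvalueDeriv A ρ β| ≤ |ρ ^ 2 * a| + |b| + |C| :=
        htriangle.trans (add_le_add (abs_add_le _ _) (le_abs_self C))
    _ = |a| * ρ ^ 2 + (|b| + |C|) := by
        rw [abs_mul, abs_of_nonneg (sq_nonneg ρ), mul_comm, add_assoc]
    _ ≤ |a| * ρ ^ 2 + (|b| + |C|) * ρ ^ 2 := by
        gcongr
        exact le_mul_of_one_le_right (by positivity) (one_le_pow₀ hρ)
    _ = _ := (add_mul _ _ _).symm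

theorem exists_abs_eigenvalueDeriv_le {β : Fin d → ℕ} (hβ : 4 < ∑ j, β j) :
    ∃ C, ∀ ρ : ℝ, 1 ≤ ρ → |eigenvalueDeriv A ρ β| ≤ C := by
  refine exists_le_of_le_div_sq ?_
  simpa only [multiPartial_quarticSymbol hβ.ne', multiPartial_meanQuadratic A
    (show ∑ j, β j ≠ 2 by omega), mul_zero, add_zero, sub_zero] using
    exists_abs_eigenvalueDeriv_sub_le_div_sq hA β

end UniformBounds

end Expansion

end BlochWave

end

open BlochWave in
theorem theorem5p4_general {d : ℕ} (A : (Fin d → ℝ) → Matrix (Fin d) (Fin d) ℝ)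
    (hA : IsBoundedPosSemidef A) :
    (∀ ρ : ℝ, 1 ≤ ρ →
      (∀ᶠ η in 𝓝 (0 : Fin d → ℝ),
        IsLeast (blochEigenvalues A ρ η) (firstEigenvalue A ρ η) ∧
        (∃! φ, IsNormalizedGroundState A ρ η φ) ∧
        IsNormalizedGroundState A ρ η (firstEigenfunction A ρ η)) ∧
      AnalyticAt ℝ (firstEigenvalue A ρ) 0 ∧
      AnalyticAt ℝ (firstEigenfunction A ρ) 0) ∧
    (∀ j : Fin d,
      (∃ C : ℝ, ∀ ρ : ℝ, 1 ≤ ρ →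
        eigenfunctionDerivNorm A ρ (unitIndex j) ≤ C / ρ ^ 2) ∧
      (∀ ρ : ℝ, 1 ≤ ρ → eigenvalueDeriv A ρ (unitIndex j) = 0)) ∧
    (∀ j k : Fin d,
      (∃ C : ℝ, ∀ ρ : ℝ, 1 ≤ ρ →
        eigenfunctionDerivNorm A ρ
          (unitIndex j + unitIndex k) ≤ C / ρ ^ 2) ∧
      (∃ C : ℝ, ∀ ρ : ℝ, 1 ≤ ρ →
        |1 / 2 * eigenvalueDeriv A ρ (unitIndex j + unitIndex k)
          - meanY (fun y => A y j k)| ≤ C / ρ ^ 2)) ∧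
    (∀ j k l : Fin d,
      (∃ C : ℝ, ∀ ρ : ℝ, 1 ≤ ρ →
        eigenfunctionDerivNorm A ρ
          (unitIndex j + unitIndex k + unitIndex l) ≤ C / ρ ^ 2) ∧
      (∀ ρ : ℝ, 1 ≤ ρ → eigenvalueDeriv A ρ
          (unitIndex j + unitIndex k + unitIndex l) = 0)) ∧
    (∀ β : Fin d → ℕ, 4 ≤ ∑ j, β j →
      ∃ C : ℝ, ∀ ρ : ℝ, 1 ≤ ρ → eigenfunctionDerivNorm A ρ β ≤ C) ∧
    (∀ β : Fin d → ℕ, ∑ j, β j = 4 →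
      ∃ C : ℝ, ∀ ρ : ℝ, 1 ≤ ρ → |eigenvalueDeriv A ρ β| ≤ C * ρ ^ 2) ∧
    (∀ β : Fin d → ℕ, 4 < ∑ j, β j →
      ∃ C : ℝ, ∀ ρ : ℝ, 1 ≤ ρ → |eigenvalueDeriv A ρ β| ≤ C) := by
  have hpair (j k : Fin d) : ∑ i, (unitIndex j + unitIndex k) i = 2 := by
    simp only [Pi.add_apply, Finset.sum_add_distrib, sum_unitIndex]
  have htriple (j k l : Fin d) : ∑ i, (unitIndex j + unitIndex k + unitIndex l) i = 3 := by
    simp only [Pi.add_apply, Finset.sum_add_distrib, sum_unitIndex]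
  refine ⟨fun ρ hρ => ?_, fun j => ⟨?_, fun ρ hρ => ?_⟩, fun j k => ⟨?_, ?_⟩,
    fun j k l => ⟨?_, fun ρ hρ => ?_⟩, fun β hβ => ?_, fun β _ => ?_, fun β hβ => ?_⟩
  · obtain ⟨χ, r, h⟩ := exists_isEigenpairExpansion hA hρ
    exact ⟨h.eventually_isLeast_and_existsUnique, h.analyticAt_firstEigenvalue,
      h.analyticAt_firstEigenfunction⟩
  · exact exists_eigenfunctionDerivNorm_le_div_sq hA (by simp [sum_unitIndex])
  · exact eigenvalueDeriv_eq_zero_of_odd hA hρ (by simp [sum_unitIndex])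
  · exact exists_eigenfunctionDerivNorm_le_div_sq hA (by rw [hpair]; decide)
  · exact exists_abs_half_eigenvalueDeriv_sub_le_div_sq hA j k
  · exact exists_eigenfunctionDerivNorm_le_div_sq hA (by rw [htriple]; decide)
  · exact eigenvalueDeriv_eq_zero_of_odd hA hρ (by rw [htriple]; decide)
  · exact exists_le_of_le_div_sq (exists_eigenfunctionDerivNorm_le_div_sq hA (by omega))
  · exact exists_abs_eigenvalueDeriv_le_mul_sq hA β
  · exact exists_abs_eigenvalueDeriv_le hA hβ

theorem theorem5p4 {d : ℕ} (A : (Fin d → ℝ) → Matrix (Fin d) (Fin d) ℝ)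
    (hA : BlochWave.IsPeriodicElliptic A) :
    -- the first Bloch eigenpair is well defined and analytic near the origin
    (∀ ρ : ℝ, 1 ≤ ρ →
      (∀ᶠ η in 𝓝 (0 : Fin d → ℝ),
        IsLeast (BlochWave.blochEigenvalues A ρ η) (BlochWave.firstEigenvalue A ρ η) ∧
        (∃! φ, BlochWave.IsNormalizedGroundState A ρ η φ) ∧
        BlochWave.IsNormalizedGroundState A ρ η (BlochWave.firstEigenfunction A ρ η)) ∧
      AnalyticAt ℝ (BlochWave.firstEigenvalue A ρ) 0 ∧
      AnalyticAt ℝ (BlochWave.firstEigenfunction A ρ) 0) ∧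
    -- first order
    (∀ j : Fin d,
      (∃ C : ℝ, ∀ ρ : ℝ, 1 ≤ ρ →
        BlochWave.eigenfunctionDerivNorm A ρ (BlochWave.unitIndex j) ≤ C / ρ ^ 2) ∧
      (∀ ρ : ℝ, 1 ≤ ρ → BlochWave.eigenvalueDeriv A ρ (BlochWave.unitIndex j) = 0)) ∧
    -- second order
    (∀ j k : Fin d,
      (∃ C : ℝ, ∀ ρ : ℝ, 1 ≤ ρ →
        BlochWave.eigenfunctionDerivNorm A ρ
          (BlochWave.unitIndex j + BlochWave.unitIndex k) ≤ C / ρ ^ 2) ∧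
      (∃ C : ℝ, ∀ ρ : ℝ, 1 ≤ ρ →
        |1 / 2 * BlochWave.eigenvalueDeriv A ρ (BlochWave.unitIndex j + BlochWave.unitIndex k)
          - BlochWave.meanY (fun y => A y j k)| ≤ C / ρ ^ 2)) ∧
    -- third order
    (∀ j k l : Fin d,
      (∃ C : ℝ, ∀ ρ : ℝ, 1 ≤ ρ →
        BlochWave.eigenfunctionDerivNorm A ρ
          (BlochWave.unitIndex j + BlochWave.unitIndex k + BlochWave.unitIndex l) ≤ C / ρ ^ 2) ∧
      (∀ ρ : ℝ, 1 ≤ ρ → BlochWave.eigenvalueDeriv A ρ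
          (BlochWave.unitIndex j + BlochWave.unitIndex k + BlochWave.unitIndex l) = 0)) ∧
    -- eigenfunction, order at least four
    (∀ β : Fin d → ℕ, 4 ≤ ∑ j, β j →
      ∃ C : ℝ, ∀ ρ : ℝ, 1 ≤ ρ → BlochWave.eigenfunctionDerivNorm A ρ β ≤ C) ∧
    -- eigenvalue, order four
    (∀ β : Fin d → ℕ, ∑ j, β j = 4 →
      ∃ C : ℝ, ∀ ρ : ℝ, 1 ≤ ρ → |BlochWave.eigenvalueDeriv A ρ β| ≤ C * ρ ^ 2) ∧
    -- eigenvalue, order greater than four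
    (∀ β : Fin d → ℕ, 4 < ∑ j, β j →
      ∃ C : ℝ, ∀ ρ : ℝ, 1 ≤ ρ → |BlochWave.eigenvalueDeriv A ρ β| ≤ C) := by
  exact theorem5p4_general A hA.isBoundedPosSemidef
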